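/- Let $\delta\in\mathbb C$, and let $W$ be the complex vector space of all analytic functions $f:(0,\infty)\to\mathbb C$ such that $f$ and all its derivatives tend to $0$ faster than any inverse power of $x$ as $x\to\infty$. On $W$ consider the operators $$A(u)=(u-\tfrac12)x^{-1}+\partial_x+\tfrac12x^{-1}+\frac{\delta}{u-\frac12},\qquad B(u)=x^{-2},$$ $$C(u)=-x^2\partial_x^2-x\partial_x+\tfrac14x^2+2\delta x+u^2,\qquad D(u)=(u+\tfrac32)x^{-1}-\partial_x-\tfrac12x^{-1}+\frac{\delta}{u-\frac12},$$ defined for $u\in S_\delta$, where $S_0=\mathbb C$ (the terms with $\delta$ being absent for $\delta=0$) and $S_\delta=\mathbb C\setminus\{\frac12\}$ if $\delta\ne0$. Let $\Psi(a,c;x)$ be Tricomi's confluent hypergeometric function, i.e. the analytic solution on $(0,\infty)$ of $xf''+(c-x)f'-af=0$ of at most polynomial growth as $x\to\infty$, normalized by $f(x)=x^{-a}+O(|x^{-a-1}|)$ as $x\to\infty$, and put $$F(u)(x)=x^u e^{-x/2}\,\Psi(2\delta+\tfrac12+u,\,2u+1;\,x).$$ Then $F(u)\in W$ for all $u\in\mathbb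 C$. Moreover, in each of the cases (1)--(3) below, with $\mathcal D=\{u_0+m: m\in\mathbb Z,\ j_-<m<j_+\}$, the following holds. (a) The operators preserve $W$ and $U(u)=\begin{pmatrix}A(u)&B(u)\\C(u)&D(u)\end{pmatrix}$, $u\in S_\delta$, gives a representation on $W$ of the QISM II algebra with spectral parameter in $S_\delta$. This is the complex algebra generated by the entries of $U(u)$, $u\in S_\delta$, with relations $$R(u-v)\,U^{(1)}(u)\,R(u+v-1)\,U^{(2)}(v)=U^{(2)}(v)\,R(u+v-1)\,U^{(1)}(u)\,R(u-v),\qquad u,v\in S_\delta,$$ where $R(u)=u+P$, $P$ is the flip on $\mathbb C^2\otimes\mathbb C^2$, $U^{(1)}=U\otimes I$, $U^{(2)}=I\otimes U$, and, whenever $u,-u\in S_\delta$, $$-A(-u)=D(u)-\frac{A(u)+D(u)}{2u+1},\quad -D(-u)=A(u)-\frac{A(u)+D(u)}{2u+1}\quad(u\ne-\tfrac12),\qquad B(-u)=B(u),\quad C(-u)=C(u).$$ (b) $u,-u\in S_\delta$ for every $u\in\mathcal D$, and $\{w\in W: C(u)w=0\}$ is one-dimensional and contains $F(u)\neq0$.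 (c) If $u\in\mathcal D$, $0\ne w\in W$ and $C(u)w=0$, then $A(u)w=0$ if and only if $j_-$ is finite and $u=u_0+j_-+1$; and $-A(-u)w=0$ if and only if $j_+$ is finite and $u=u_0+j_+-1$. The cases are: (1) $\mathcal D=u_0+\mathbb Z$ (that is, $j_\pm=\pm\infty$), if $u_0\notin\pm(2\delta+\frac12)+\mathbb Z$ and $u_0\notin\frac12+\mathbb Z$; (2) $\mathcal D=\{-2\delta-\frac12,\,-2\delta-\frac12-1,\,-2\delta-\frac12-2,\dots\}$ (with $u_0=-2\delta-\frac12$, $j_-=-\infty$, $j_+=1$), if $\delta\ne0$ and $-4\delta-1\ne0,1,2,\dots$; (3) $\mathcal D=\{2\delta+\frac12,\,2\delta+\frac12+1,\dots,-2\delta-\frac12\}$ (with $u_0=2\delta+\frac12$, $j_-=-1$, $j_+=-4\delta$), if $2\delta+\frac12\in\{0,-1,-2,\dots\}$. In cases (2) and (3) every $u\in\mathcal D$ has the form $u=-2\delta-\frac12-n$ with $n\in\{0,1,2,\dots\}$, and $$F(u)(x)=(-1)^n\,n!\;x^{u}e^{-x/2}L_n^{(2u)}(x)=(-1)^n\,n!\;x^{-2\delta-\frac12}e^{-x/2}\,\widetilde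 L_n^{(2u)}(x^{-1}),$$ where $L_n^{(\alpha)}(x)=\sum_{k=0}^n\frac{(\alpha+k+1)_{n-k}}{(n-k)!}\frac{(-x)^k}{k!}$ is the Laguerre polynomial and $\widetilde L_n^{(\alpha)}(y)=y^nL_n^{(\alpha)}(1/y)$ is the polynomial with the reversed list of coefficients. -/

import Mathlib

open scoped Kronecker Topology

noncomputable section

/-! ## The quadratic algebra -/

/-- The rational `4 × 4` matrix `R(u) = u + P`, `P` the flip of `ℂ² ⊗ ℂ²`, with entries in a
complex algebra. -/
def rMatrix (𝒜 : Type*) [Ring 𝒜] [Algebra ℂ 𝒜] (u : ℂ) :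
    Matrix (Fin 2 × Fin 2) (Fin 2 × Fin 2) 𝒜 :=
  u • (1 : Matrix (Fin 2 × Fin 2) (Fin 2 × Fin 2) 𝒜) +
    Matrix.of fun p q => if p.1 = q.2 ∧ p.2 = q.1 then (1 : 𝒜) else 0

/-- `M ⊗ I`. -/
def firstLeg {𝒜 : Type*} [Ring 𝒜] (M : Matrix (Fin 2) (Fin 2) 𝒜) :
    Matrix (Fin 2 × Fin 2) (Fin 2 × Fin 2) 𝒜 :=
  M ⊗ₖ (1 : Matrix (Fin 2) (Fin 2) 𝒜)

/-- `I ⊗ M`. -/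
def secondLeg {𝒜 : Type*} [Ring 𝒜] (M : Matrix (Fin 2) (Fin 2) 𝒜) :
    Matrix (Fin 2 × Fin 2) (Fin 2 × Fin 2) 𝒜 :=
  (1 : Matrix (Fin 2) (Fin 2) 𝒜) ⊗ₖ M

/-- `R(u-v) U⁽¹⁾(u) R(u+v-1) U⁽²⁾(v)`, where `M = U(u)` and `N = U(v)`. -/
def reflectionLeft {𝒜 : Type*} [Ring 𝒜] [Algebra ℂ 𝒜] (u v : ℂ)
    (M N : Matrix (Fin 2) (Fin 2) 𝒜) : Matrix (Fin 2 × Fin 2) (Fin 2 × Fin 2) 𝒜 :=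
  rMatrix 𝒜 (u - v) * firstLeg M * rMatrix 𝒜 (u + v - 1) * secondLeg N

/-- `U⁽²⁾(v) R(u+v-1) U⁽¹⁾(u) R(u-v)`, where `M = U(u)` and `N = U(v)`. -/
def reflectionRight {𝒜 : Type*} [Ring 𝒜] [Algebra ℂ 𝒜] (u v : ℂ)
    (M N : Matrix (Fin 2) (Fin 2) 𝒜) : Matrix (Fin 2 × Fin 2) (Fin 2 × Fin 2) 𝒜 :=
  secondLeg N * rMatrix 𝒜 (u + v - 1) * firstLeg M * rMatrix 𝒜 (u - v)

/-- The free complex algebra on the entries of the matrices `U(u)`, `u ∈ S`. -/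
abbrev FreeQISM (S : Set ℂ) : Type := FreeAlgebra ℂ (S × Fin 2 × Fin 2)

/-- The matrix `U(u) = !![A(u), B(u); C(u), D(u)]` of free generators. -/
def freeU (S : Set ℂ) (u : S) : Matrix (Fin 2) (Fin 2) (FreeQISM S) :=
  Matrix.of fun i j => FreeAlgebra.ι ℂ (u, i, j)

/-- The defining relations of the QISM II algebra: the entries of
`R(u-v) U⁽¹⁾(u) R(u+v-1) U⁽²⁾(v) = U⁽²⁾(v) R(u+v-1) U⁽¹⁾(u) R(u-v)`, and the symmetry relations
under `u ↦ -u`. -/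
inductive QISMRel (S : Set ℂ) : FreeQISM S → FreeQISM S → Prop
  | reflection (u v : S) (p q : Fin 2 × Fin 2) :
      QISMRel S (reflectionLeft (u : ℂ) v (freeU S u) (freeU S v) p q)
        (reflectionRight (u : ℂ) v (freeU S u) (freeU S v) p q)
  | symmA (u v : S) (hv : (v : ℂ) = -u) (hu : 2 * (u : ℂ) + 1 ≠ 0) :
      QISMRel S (-freeU S v 0 0)
        (freeU S u 1 1 - (2 * (u : ℂ) + 1)⁻¹ • (freeU S u 0 0 + freeU S u 1 1))
  | symmD (u v : S) (hv : (v : ℂ) = -u) (hu : 2 * (u : ℂ) + 1 ≠ 0) :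
      QISMRel S (-freeU S v 1 1)
        (freeU S u 0 0 - (2 * (u : ℂ) + 1)⁻¹ • (freeU S u 0 0 + freeU S u 1 1))
  | symmB (u v : S) (hv : (v : ℂ) = -u) : QISMRel S (freeU S v 0 1) (freeU S u 0 1)
  | symmC (u v : S) (hv : (v : ℂ) = -u) : QISMRel S (freeU S v 1 0) (freeU S u 1 0)

/-- The (unitary) QISM II algebra whose spectral parameter ranges over `S ⊆ ℂ`. -/
abbrev QISMAlgebra (S : Set ℂ) : Type := RingQuot (QISMRel S)

/-- The generators of the QISM II algebra; the entries `(0,0)`, `(0,1)`, `(1,0)`, `(1,1)` are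
`A(u)`, `B(u)`, `C(u)`, `D(u)`. -/
def qismGen (S : Set ℂ) (u : S) : Matrix (Fin 2) (Fin 2) (QISMAlgebra S) :=
  (freeU S u).map (RingQuot.mkAlgHom ℂ (QISMRel S))

/-- The operators `U(u)`, `u ∈ S`, give an algebra representation of the QISM II algebra
(spectral parameter in `S`) on `W`. -/
def IsQISMRep (S : Set ℂ) {W : Type*} [AddCommGroup W] [Module ℂ W]
    (U : ℂ → Matrix (Fin 2) (Fin 2) (Module.End ℂ W)) : Prop :=
  ∃ ρ : QISMAlgebra S →ₐ[ℂ] Module.End ℂ W, ∀ (u : S) (i j : Fin 2), ρ (qismGen S u i j) = U u i j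

/-- The set `{u₀ + m | m ∈ ℤ, j₋ < m < j₊}`, where `j₋` is an integer or `-∞` (`⊥`) and
`j₊` is an integer or `+∞` (`⊤`). -/
def ladder (u₀ : ℂ) (jm : WithBot ℤ) (jp : WithTop ℤ) : Set ℂ :=
  {u | ∃ m : ℤ, jm < (m : WithBot ℤ) ∧ (m : WithTop ℤ) < jp ∧ u = u₀ + m}

/-- The hypotheses of the theorem on parameter shifting: a representation of the QISM II algebra
on `W`, a set `𝒟 = ladder u₀ jm jp` of parameters `u` at which the operators `A(u)`, `-A(-u)`,
`C(u)` exist, such that the null space of `C(u)` on `W` is one-dimensional, `A(u)` annihilates it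
exactly at the lower end of `𝒟` and `-A(-u)` annihilates it exactly at the upper end of `𝒟`,
and a choice of nonzero elements `F(u)` of these null spaces. -/
structure MeetsShiftHypotheses (S : Set ℂ) {W : Type*} [AddCommGroup W] [Module ℂ W]
    (U : ℂ → Matrix (Fin 2) (Fin 2) (Module.End ℂ W))
    (u₀ : ℂ) (jm : WithBot ℤ) (jp : WithTop ℤ) (F : ℂ → W) : Prop where
  isRep : IsQISMRep S U
  mem_domain : ∀ u ∈ ladder u₀ jm jp, u ∈ S ∧ -u ∈ S
  one_dim : ∀ u ∈ ladder u₀ jm jp, Module.finrank ℂ (LinearMap.ker (U u 1 0)) = 1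
  lowering : ∀ u ∈ ladder u₀ jm jp, ∀ w : W, w ≠ 0 → U u 1 0 w = 0 →
    (U u 0 0 w = 0 ↔ ∃ j : ℤ, jm = (j : WithBot ℤ) ∧ u = u₀ + j + 1)
  raising : ∀ u ∈ ladder u₀ jm jp, ∀ w : W, w ≠ 0 → U u 1 0 w = 0 →
    ((-U (-u) 0 0) w = 0 ↔ ∃ j : ℤ, jp = (j : WithTop ℤ) ∧ u = u₀ + j - 1)
  ne_zero : ∀ u ∈ ladder u₀ jm jp, F u ≠ 0
  annihilated : ∀ u ∈ ladder u₀ jm jp, U u 1 0 (F u) = 0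

/-! ## The function space -/

/-- Membership in `W`: `f` is a complex-valued analytic function on `(0, ∞)`, and `f` and all its
derivatives tend to `0` at `∞` faster than any inverse power of `x`. A function on `(0, ∞)` is
represented by its extension by zero to `ℝ`. -/
structure IsRapid (f : ℝ → ℂ) : Prop where
  zero : ∀ x ≤ 0, f x = 0
  analytic : AnalyticOnNhd ℝ f (Set.Ioi 0)
  decay : ∀ p N : ℕ,
    Filter.Tendsto (fun x : ℝ => (x : ℂ) ^ N * iteratedDeriv p f x) Filter.atTop (𝓝 0)

theorem IsRapid.contDiffAt {f : ℝ → ℂ} (hf : IsRapid f) (n : ℕ) {x : ℝ} (hx : 0 < x) :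
    ContDiffAt ℝ n f x := (hf.analytic x hx).contDiffAt

theorem isRapid_zero : IsRapid 0 where
  zero := by simp
  analytic := fun x _ => analyticAt_const
  decay := by
    intro p N
    simp

theorem IsRapid.add {f g : ℝ → ℂ} (hf : IsRapid f) (hg : IsRapid g) : IsRapid (f + g) where
  zero := fun x hx => by simp [hf.zero x hx, hg.zero x hx]
  analytic := hf.analytic.add hg.analytic
  decay := by
    intro p N
    have h := (hf.decay p N).add (hg.decay p N)
    rw [add_zero] at h
    refine h.congr' ?_
    filter_upwards [Filter.eventually_gt_atTop 0] with x hx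
    rw [iteratedDeriv_add (hf.contDiffAt p hx) (hg.contDiffAt p hx)]
    ring

/-- Multiplication by an analytic function on `(0, ∞)` all of whose derivatives grow at most
polynomially preserves `W`. -/
theorem IsRapid.mul {f g : ℝ → ℂ} (hf : IsRapid f) (hg : AnalyticOnNhd ℝ g (Set.Ioi 0))
    (k : ℕ) (hb : ∀ i : ℕ, ∃ c : ℝ, ∀ x : ℝ, 1 ≤ x → ‖iteratedDeriv i g x‖ ≤ c * x ^ k) :
    IsRapid (g * f) where
  zero := fun x hx => by simp [hf.zero x hx]
  analytic := hg.mul hf.analytic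
  decay := by
    intro p N
    have key : ∀ i ∈ Finset.range (p + 1), Filter.Tendsto (fun x : ℝ =>
        (x : ℂ) ^ N * ((p.choose i : ℂ) * iteratedDeriv i g x * iteratedDeriv (p - i) f x))
        Filter.atTop (𝓝 0) := by
      intro i _
      obtain ⟨c, hc⟩ := hb i
      have h := ((hf.decay (p - i) (N + k)).norm).const_mul ((p.choose i : ℝ) * c)
      rw [norm_zero, mul_zero] at h
      refine squeeze_zero_norm' ?_ h
      filter_upwards [Filter.eventually_ge_atTop 1] with x hx
      have hx0 : 0 ≤ x := by linarith
      simp only [norm_mul, norm_pow, Complex.norm_real, Real.norm_of_nonneg hx0,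
        Complex.norm_natCast]
      calc x ^ N * ((p.choose i : ℝ) * ‖iteratedDeriv i g x‖ * ‖iteratedDeriv (p - i) f x‖)
          ≤ x ^ N * ((p.choose i : ℝ) * (c * x ^ k) * ‖iteratedDeriv (p - i) f x‖) := by
            gcongr
            exact hc x hx
        _ = (p.choose i : ℝ) * c * (x ^ (N + k) * ‖iteratedDeriv (p - i) f x‖) := by ring
    have hs := tendsto_finsetSum _ key
    rw [Finset.sum_const_zero] at hs
    refine hs.congr' ?_
    filter_upwards [Filter.eventually_gt_atTop 0] with x hx
    rw [iteratedDeriv_mul (hg x hx).contDiffAt (hf.contDiffAt p hx), Finset.mul_sum]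

theorem IsRapid.const_mul {f : ℝ → ℂ} (hf : IsRapid f) (c : ℂ) : IsRapid (c • f) := by
  refine hf.mul (g := fun _ => c) (fun x _ => analyticAt_const) 0 (fun i => ⟨‖c‖, fun x _ => ?_⟩)
  rw [iteratedDeriv_const]
  split_ifs <;> simp

theorem IsRapid.deriv {f : ℝ → ℂ} (hf : IsRapid f) : IsRapid (deriv f) where
  zero := by
    intro x hx
    by_cases h : DifferentiableAt ℝ f x
    · have h1 : HasDerivWithinAt f (_root_.deriv f x) (Set.Iic x) x :=
        h.hasDerivAt.hasDerivWithinAt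
      have h2 : HasDerivWithinAt f 0 (Set.Iic x) x :=
        (hasDerivWithinAt_const x (Set.Iic x) (0 : ℂ)).congr
          (fun y hy => hf.zero y (le_trans hy hx)) (hf.zero x hx)
      exact (uniqueDiffWithinAt_Iic x).eq_deriv _ h1 h2
    · exact deriv_zero_of_not_differentiableAt h
  analytic := hf.analytic.deriv
  decay := by
    intro p N
    have h := hf.decay (p + 1) N
    rwa [iteratedDeriv_succ'] at h

theorem IsRapid.mulX {f : ℝ → ℂ} (hf : IsRapid f) : IsRapid ((fun x : ℝ => (x : ℂ)) * f) := by
  have ha : AnalyticOnNhd ℝ (fun x : ℝ => (x : ℂ)) (Set.Ioi 0) :=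
    fun x _ => Complex.ofRealCLM.analyticAt x
  refine hf.mul ha 1 (fun i => ?_)
  have hd : _root_.deriv (fun x : ℝ => (x : ℂ)) = fun _ => 1 := by
    funext x
    exact Complex.ofRealCLM.hasDerivAt.deriv
  rcases i with _ | i
  · exact ⟨1, fun x hx => by simp [abs_of_nonneg (le_trans zero_le_one hx)]⟩
  · refine ⟨1, fun x hx => ?_⟩
    rw [iteratedDeriv_succ', hd, iteratedDeriv_const]
    split_ifs
    · simpa using hx
    · simpa using le_trans zero_le_one hx

theorem IsRapid.mulXinv {f : ℝ → ℂ} (hf : IsRapid f) :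
    IsRapid ((fun x : ℝ => (x : ℂ)⁻¹) * f) := by
  have ha : AnalyticOnNhd ℝ (fun x : ℝ => (x : ℂ)⁻¹) (Set.Ioi 0) :=
    fun x hx => (Complex.ofRealCLM.analyticAt x).inv (by simpa using (ne_of_gt hx))
  have hd : ∀ i : ℕ, ∀ x : ℝ, 0 < x → iteratedDeriv i (fun x : ℝ => (x : ℂ)⁻¹) x =
      (-1) ^ i * (i.factorial : ℂ) * ((x : ℂ)⁻¹) ^ (i + 1) := by
    intro i
    induction i with
    | zero => intro x _; simp
    | succ i ih =>
      intro x hx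
      have hev : iteratedDeriv i (fun x : ℝ => (x : ℂ)⁻¹) =ᶠ[𝓝 x]
          fun x : ℝ => (-1) ^ i * (i.factorial : ℂ) * ((x : ℂ)⁻¹) ^ (i + 1) := by
        filter_upwards [lt_mem_nhds hx] with y hy using ih y hy
      have hx' : (x : ℂ) ≠ 0 := by simpa using hx.ne'
      have h1 : HasDerivAt (fun x : ℝ => (x : ℂ)⁻¹) (-((x : ℂ)⁻¹) ^ 2) x := by
        have h0 : HasDerivAt (fun x : ℝ => (x : ℂ)⁻¹) (-1 / (x : ℂ) ^ 2) x :=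
          Complex.ofRealCLM.hasDerivAt.inv hx'
        convert h0 using 1
        field_simp
      rw [iteratedDeriv_succ, hev.deriv_eq,
        HasDerivAt.deriv
          (HasDerivAt.const_mul ((-1 : ℂ) ^ i * (i.factorial : ℂ)) (h1.fun_pow (i + 1)))]
      push_cast [Nat.factorial_succ]
      ring
  refine hf.mul ha 0 (fun i => ⟨i.factorial, fun x hx => ?_⟩)
  have hx0 : 0 < x := by linarith
  rw [hd i x hx0]
  simp only [norm_mul, norm_pow, norm_neg, norm_one, one_pow, one_mul, Complex.norm_natCast,
    norm_inv, Complex.norm_real, Real.norm_of_nonneg hx0.le, pow_zero]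
  exact mul_le_mul_of_nonneg_left (pow_le_one₀ (by positivity) (inv_le_one_of_one_le₀ hx))
    (by positivity)

/-- The space `W`. -/
def rapidSpace : Submodule ℂ (ℝ → ℂ) where
  carrier := {f | IsRapid f}
  add_mem' := fun hf hg => IsRapid.add hf hg
  zero_mem' := isRapid_zero
  smul_mem' := fun c _ hf => IsRapid.const_mul hf c

/-- The operator `∂ₓ` on `W`. -/
def opD : Module.End ℂ rapidSpace where
  toFun f := ⟨deriv f.1, IsRapid.deriv f.2⟩
  map_add' f g := by
    apply Subtype.ext
    funext x
    rcases le_or_gt x 0 with hx | hx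
    · have h1 := (IsRapid.deriv (f + g).2).zero x hx
      have h2 := (IsRapid.deriv f.2).zero x hx
      have h3 := (IsRapid.deriv g.2).zero x hx
      simpa [h2, h3] using h1
    · exact deriv_add ((IsRapid.analytic f.2 x hx).differentiableAt)
        ((IsRapid.analytic g.2 x hx).differentiableAt)
  map_smul' c f := by
    apply Subtype.ext
    funext x
    exact deriv_const_smul_field c f.1

/-- The operator of multiplication by `x` on `W`. -/
def opX : Module.End ℂ rapidSpace where
  toFun f := ⟨(fun x : ℝ => (x : ℂ)) * f.1, IsRapid.mulX f.2⟩
  map_add' _ _ := Subtype.ext (mul_add _ _ _)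
  map_smul' c _ := Subtype.ext (mul_smul_comm c _ _)

/-- The operator of multiplication by `x⁻¹` on `W`. -/
def opXinv : Module.End ℂ rapidSpace where
  toFun f := ⟨(fun x : ℝ => (x : ℂ)⁻¹) * f.1, IsRapid.mulXinv f.2⟩
  map_add' _ _ := Subtype.ext (mul_add _ _ _)
  map_smul' c _ := Subtype.ext (mul_smul_comm c _ _)

/-! ## The operators -/

/-- `A₁ = x⁻¹`. -/
def opA1 : Module.End ℂ rapidSpace := opXinv

/-- `A₀ = ∂ₓ + ½ x⁻¹`. -/
def opA0 : Module.End ℂ rapidSpace := opD + (1 / 2 : ℂ) • opXinv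

/-- `A(u) = (u - ½) A₁ + A₀ + δ / (u - ½)`. The last term is absent if `δ = 0`; if `δ ≠ 0` the
operator is only used for `u ≠ ½`. -/
def opA (δ u : ℂ) : Module.End ℂ rapidSpace :=
  (u - 1 / 2) • opA1 + opA0 + (δ / (u - 1 / 2)) • 1

/-- `B₀ = x⁻²`. -/
def opB : Module.End ℂ rapidSpace := opXinv ^ 2

/-- `C(u) = -x² ∂ₓ² - x ∂ₓ + ¼ x² + 2 δ x + u²`. -/
def opC (δ u : ℂ) : Module.End ℂ rapidSpace :=
  -(opX ^ 2 * opD ^ 2) - opX * opD + (1 / 4 : ℂ) • opX ^ 2 + (2 * δ) • opX + (u ^ 2) • 1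

/-- `D(u) = (u + 3/2) A₁ - A₀ + δ / (u - ½)`. -/
def opDD (δ u : ℂ) : Module.End ℂ rapidSpace :=
  (u + 3 / 2) • opA1 - opA0 + (δ / (u - 1 / 2)) • 1

/-- The `L`-operator. -/
def opU (δ u : ℂ) : Matrix (Fin 2) (Fin 2) (Module.End ℂ rapidSpace) :=
  !![opA δ u, opB; opC δ u, opDD δ u]

/-- The values of the spectral parameter at which the `L`-operator is defined: all of `ℂ` if
`δ = 0`, and `ℂ ∖ {½}` if `δ ≠ 0`. -/
def spectralSet (δ : ℂ) : Set ℂ := {u | δ = 0 ∨ u ≠ 1 / 2}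

/-! ## Special functions -/

/-- The characterization of Tricomi's function `x ↦ Ψ(a, c; x)` on `(0, ∞)`: it is the
analytic solution of `x f'' + (c - x) f' - a f = 0` of at most polynomial growth at `∞`, normalized
by `f(x) = x^{-a} + O(|x^{-a-1}|)` as `x → ∞`. -/
structure IsTricomiPsi (a c : ℂ) (f : ℝ → ℂ) : Prop where
  analytic : AnalyticOnNhd ℝ f (Set.Ioi 0)
  ode : ∀ x : ℝ, 0 < x →
    (x : ℂ) * iteratedDeriv 2 f x + (c - (x : ℂ)) * deriv f x - a * f x = 0
  growth : ∃ N : ℕ, f =O[Filter.atTop] fun x : ℝ => x ^ N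
  normalized : (fun x : ℝ => f x - (x : ℂ) ^ (-a)) =O[Filter.atTop] fun x : ℝ => (x : ℂ) ^ (-a - 1)

open Classical in
/-- Tricomi's function `Ψ(a, c; x)` for `x > 0` and arbitrary complex `a`, `c`, defined by its
characterization (with the value `0` if there were no such function). -/
def tricomiPsi (a c : ℂ) (x : ℝ) : ℂ :=
  if h : ∃ f, IsTricomiPsi a c f then h.choose x else 0

/-- The Laguerre polynomial
`L_n^{(α)}(X) = ∑_{k ≤ n} (α + k + 1)_{n-k} / (n-k)! * (-X)^k / k!`. -/
def laguerrePoly (n : ℕ) (α : ℂ) : Polynomial ℂ :=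
  ∑ k ∈ Finset.range (n + 1), Polynomial.monomial k
    ((-1) ^ k * (ascPochhammer ℂ (n - k)).eval (α + k + 1) /
      ((n - k).factorial * k.factorial : ℂ))

/-- The values of `F` at `u` are a Laguerre polynomial times an exponential and a power: for some
`n`, `u = -2δ - ½ - n` and `F(u)(x) = (-1)ⁿ n! x^u e^{-x/2} L_n^{(2u)}(x)`; equivalently `F(u)(x)`
is `(-1)ⁿ n! x^{-2δ-1/2} e^{-x/2}` times the value at `x⁻¹` of the polynomial with the reversed
list of coefficients. -/
def IsLaguerreForm (δ u : ℂ) (f : rapidSpace) : Prop :=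
  ∃ n : ℕ, u = -2 * δ - 1 / 2 - n ∧ ∀ x : ℝ, 0 < x →
    f.1 x = (-1) ^ n * (n.factorial : ℂ) * (x : ℂ) ^ u * Complex.exp (-(x : ℂ) / 2) *
        (laguerrePoly n (2 * u)).eval (x : ℂ) ∧
    f.1 x = (-1) ^ n * (n.factorial : ℂ) * (x : ℂ) ^ (-2 * δ - 1 / 2) *
        Complex.exp (-(x : ℂ) / 2) * (laguerrePoly n (2 * u)).reverse.eval ((x : ℂ)⁻¹)

end

/-! Everything about `opU` is reduced to algebra in $Y=x^{-1}$, $D=\partial_x$ and $C=C(0)$. The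
relations in `IsShiftTriple` reorder every product into a combination of $Y^iD^\varepsilon C^j$ with
$\varepsilon\le 1$, so the reflection equation becomes sixteen identities between scalar
coefficients (`IsShiftTriple.reflection`). The parameter enters only through
$\kappa=\delta/(u-\frac12)$ and the equation $\kappa(u-\frac12)=\delta$, which also covers
$\delta=0$.

Tricomi's function is the Laplace transform of $t^{a-1}(1+t)^{c-a-1}/\Gamma(a)$ when
$\operatorname{Re}a>0$. The contiguous relation `IsTricomiPsiStrong.lower` carries this down to
every $a$; the induction needs a bound on the derivative, hence the strengthened characterization.
Uniqueness is a Wronskian argument that uses no bound on the derivative of the competing solution.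
So `tricomiPsi` agrees with the constructed function, and, for $a=-n$, with a normalized Laguerre
polynomial.

Multiplication by $x^ue^{-x/2}$ turns the confluent equation into $C(u)w=0$. That equation expresses
all derivatives of $w$ through $w$ and $w'$, so $F(u)\in W$. For two solutions in $W$, $x$ times the
Wronskian is constant and tends to $0$: the null space is a line.

Finally, $((u-1)Y-D+\kappa)A(u)=Y^2C(u)+\kappa^2-\frac14$ (`IsShiftTriple.factor`). Hence $A(u)$ can
kill a null vector of $C(u)$ only if $\kappa=\pm\frac12$, that is, $u=\frac12\pm2\delta$. The
ladders meet these values only at their finite ends. There the vanishing is checked directly, as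
$F(-2\delta-\frac12)=x^ue^{-x/2}$ is killed by a first-order operator; the lower end follows from
$C(-u)=C(u)$. -/

noncomputable section

/-! ## Laplace transforms -/

open MeasureTheory Set Filter Asymptotics

/-- `p` is measurable on `(0, ∞)` and bounded there by a multiple of `t ^ (s - 1) * exp (ε t)` for
every `ε > 0`. -/
structure HasLaplaceBound (s : ℝ) (p : ℝ → ℂ) : Prop where
  meas : AEStronglyMeasurable p (volume.restrict (Ioi 0))
  bound : ∀ ε : ℝ, 0 < ε → ∃ C : ℝ, ∀ t : ℝ, 0 < t → ‖p t‖ ≤ C * (t ^ (s - 1) * Real.exp (ε * t))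

/-- The Laplace transform. -/
def laplace (p : ℝ → ℂ) (z : ℂ) : ℂ := ∫ t in Ioi (0 : ℝ), Complex.exp (-z * t) * p t

theorem integrableOn_rpow_mul_exp {s r : ℝ} (hs : 0 < s) (hr : 0 < r) :
    IntegrableOn (fun t : ℝ => t ^ (s - 1) * Real.exp (-(r * t))) (Ioi 0) := by
  have := integrableOn_rpow_mul_exp_neg_mul_rpow (p := 1) (s := s - 1) (b := r)
    (by linarith) one_pos hr
  simpa using this

theorem norm_exp_mul_le {p : ℝ → ℂ} {s ε C : ℝ}
    (hC : ∀ t : ℝ, 0 < t → ‖p t‖ ≤ C * (t ^ (s - 1) * Real.exp (ε * t))) (z : ℂ) {t : ℝ}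
    (ht : 0 < t) :
    ‖Complex.exp (-z * t) * p t‖ ≤ C * (t ^ (s - 1) * Real.exp (-((z.re - ε) * t))) := by
  rw [norm_mul, Complex.norm_exp]
  calc _ ≤ Real.exp ((-z * t).re) * (C * (t ^ (s - 1) * Real.exp (ε * t))) := by
        gcongr
        exact hC t ht
    _ = C * (t ^ (s - 1) * (Real.exp ((-z * t).re) * Real.exp (ε * t))) := by ring
    _ = _ := by
        rw [← Real.exp_add]
        congr 3
        simp
        ring

theorem HasLaplaceBound.aestronglyMeasurable {s : ℝ} {p : ℝ → ℂ} (h : HasLaplaceBound s p)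
    (z : ℂ) :
    AEStronglyMeasurable (fun t : ℝ => Complex.exp (-z * t) * p t) (volume.restrict (Ioi 0)) := by
  refine AEStronglyMeasurable.mul ?_ h.meas
  exact Continuous.aestronglyMeasurable (by fun_prop)

theorem HasLaplaceBound.integrableOn {s : ℝ} {p : ℝ → ℂ} (hs : 0 < s) (h : HasLaplaceBound s p)
    {z : ℂ} (hz : 0 < z.re) :
    IntegrableOn (fun t : ℝ => Complex.exp (-z * t) * p t) (Ioi 0) := by
  obtain ⟨C, hC⟩ := h.bound (z.re / 2) (by linarith)
  refine Integrable.mono' ((integrableOn_rpow_mul_exp hs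
    (r := z.re - z.re / 2) (by linarith)).const_mul C) (h.aestronglyMeasurable z) ?_
  filter_upwards [ae_restrict_mem measurableSet_Ioi] with t ht
  exact norm_exp_mul_le hC z ht

/-- Decay of the Laplace transform along the positive real axis. -/
theorem HasLaplaceBound.isBigO {s : ℝ} {p : ℝ → ℂ} (hs : 0 < s) (h : HasLaplaceBound s p) :
    (fun x : ℝ => laplace p x) =O[atTop] fun x : ℝ => x ^ (-s) := by
  -- With $\varepsilon=\frac12$ and $x\ge1$ one has $x-\varepsilon\ge x/2$, which costs only the
  -- factor $2^s$.
  obtain ⟨C, hC⟩ := h.bound (1 / 2) (by norm_num)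
  refine IsBigO.of_bound (|C| * (2 ^ s * Real.Gamma s)) ?_
  filter_upwards [eventually_ge_atTop 1] with x hx
  have hx0 : 0 < x := by linarith
  have hr : 0 < x - 1 / 2 := by linarith
  have h1 : ‖laplace p x‖ ≤ ∫ t in Ioi (0 : ℝ), |C| * (t ^ (s - 1) * Real.exp (-((x - 1/2) * t))) := by
    refine norm_integral_le_of_norm_le ((integrableOn_rpow_mul_exp hs hr).const_mul _) ?_
    filter_upwards [ae_restrict_mem measurableSet_Ioi] with t ht
    refine (norm_exp_mul_le hC x ht).trans ?_
    rw [Complex.ofReal_re]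
    have : 0 ≤ t ^ (s - 1) := Real.rpow_nonneg (le_of_lt ht) _
    gcongr
    exact le_abs_self C
  rw [integral_const_mul, Real.integral_rpow_mul_exp_neg_mul_Ioi hs hr] at h1
  refine h1.trans ?_
  rw [Real.norm_of_nonneg (Real.rpow_nonneg hx0.le _), mul_assoc]
  refine mul_le_mul_of_nonneg_left ?_ (abs_nonneg C)
  have h2 : (1 / (x - 1 / 2)) ^ s ≤ (2 * x⁻¹) ^ s := by
    refine Real.rpow_le_rpow (by positivity) ?_ hs.le
    rw [div_le_iff₀ hr]
    have : x⁻¹ ≤ 1 := inv_le_one_of_one_le₀ hx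
    have h3 : x⁻¹ * x = 1 := inv_mul_cancel₀ hx0.ne'
    nlinarith
  rw [Real.mul_rpow (by norm_num) (by positivity), Real.inv_rpow hx0.le,
    ← Real.rpow_neg hx0.le] at h2
  have := mul_le_mul_of_nonneg_right h2 (Real.Gamma_pos_of_pos hs).le
  linarith

theorem HasLaplaceBound.mul_id {s : ℝ} {p : ℝ → ℂ} (h : HasLaplaceBound s p) :
    HasLaplaceBound (s + 1) (fun t => (t : ℂ) * p t) where
  meas := (Continuous.aestronglyMeasurable (by fun_prop)).mul h.meas
  bound ε hε := by
    obtain ⟨C, hC⟩ := h.bound ε hε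
    refine ⟨C, fun t ht => ?_⟩
    rw [norm_mul, Complex.norm_real, Real.norm_of_nonneg ht.le]
    have h1 : t ^ (s + 1 - 1) = t * t ^ (s - 1) := by
      rw [show s + 1 - 1 = 1 + (s - 1) by ring, Real.rpow_add ht, Real.rpow_one]
    rw [h1]
    calc _ ≤ t * (C * (t ^ (s - 1) * Real.exp (ε * t))) := by
          gcongr
          exact hC t ht
      _ = _ := by ring

theorem HasLaplaceBound.hasDerivAt {s : ℝ} {p : ℝ → ℂ} (hs : 0 < s) (h : HasLaplaceBound s p)
    {z : ℂ} (hz : 0 < z.re) :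
    HasDerivAt (laplace p) (-laplace (fun t => (t : ℂ) * p t) z) z := by
  -- On the half-plane $\operatorname{Re}w>\operatorname{Re}z/2$ this choice leaves the uniform
  -- decay rate $\operatorname{Re}z/4$ for the dominating function.
  obtain ⟨C, hC⟩ := h.mul_id.bound (z.re / 4) (by linarith)
  have hU : {w : ℂ | z.re / 2 < w.re} ∈ 𝓝 z :=
    (isOpen_lt continuous_const Complex.continuous_re).mem_nhds (by simp; linarith)
  have key := hasDerivAt_integral_of_dominated_loc_of_deriv_le (μ := volume.restrict (Ioi (0:ℝ)))
    (F := fun w t => Complex.exp (-w * t) * p t)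
    (F' := fun w t => -(Complex.exp (-w * t) * ((t : ℂ) * p t)))
    (bound := fun t => |C| * (t ^ (s + 1 - 1) * Real.exp (-((z.re / 4) * t))))
    hU (Eventually.of_forall fun w => h.aestronglyMeasurable w) (h.integrableOn hs hz)
    (h.mul_id.aestronglyMeasurable z).neg ?_
    ((integrableOn_rpow_mul_exp (by linarith) (by linarith)).const_mul _) ?_
  · have := key.2
    rwa [integral_neg] at this
  · filter_upwards [ae_restrict_mem measurableSet_Ioi] with t ht w hw
    rw [norm_neg]
    refine (norm_exp_mul_le hC w ht).trans ?_
    have ht' : (0:ℝ) < t := ht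
    have h1 : 0 ≤ t ^ (s + 1 - 1) := Real.rpow_nonneg (le_of_lt ht) _
    have h2 : z.re / 2 < w.re := hw
    refine mul_le_mul (le_abs_self C) ?_ (by positivity) (abs_nonneg C)
    gcongr
    linarith
  · refine Eventually.of_forall fun t w _ => ?_
    have h1 : HasDerivAt (fun w : ℂ => -w * (t : ℂ)) (-1 * (t : ℂ)) w :=
      (hasDerivAt_id w).neg.mul_const _
    refine (h1.cexp.mul_const (p t)).congr_deriv ?_
    ring

theorem HasLaplaceBound.hasDerivAt_ofReal {s : ℝ} {p : ℝ → ℂ} (hs : 0 < s)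
    (h : HasLaplaceBound s p) {x : ℝ} (hx : 0 < x) :
    HasDerivAt (fun y : ℝ => laplace p y) (-laplace (fun t => (t : ℂ) * p t) x) x :=
  (h.hasDerivAt hs (z := x) (by simpa using hx)).comp_ofReal

theorem HasLaplaceBound.analyticOnNhd {s : ℝ} {p : ℝ → ℂ} (hs : 0 < s) (h : HasLaplaceBound s p) :
    AnalyticOnNhd ℝ (fun y : ℝ => laplace p y) (Ioi 0) := by
  have h1 : AnalyticOnNhd ℂ (laplace p) {w : ℂ | 0 < w.re} :=
    DifferentiableOn.analyticOnNhd
      (fun z hz => (h.hasDerivAt hs hz).differentiableAt.differentiableWithinAt)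
      (isOpen_lt continuous_const Complex.continuous_re)
  intro x hx
  exact (h1.restrictScalars (𝕜 := ℝ) (x : ℂ) (by simpa using hx)).comp
    (Complex.ofRealCLM.analyticAt x)

/-! ## The integral representation of Tricomi's function -/

theorem exists_one_add_rpow_le (β : ℝ) {ε : ℝ} (hε : 0 < ε) :
    ∃ C : ℝ, 0 < C ∧ ∀ t : ℝ, 0 ≤ t → (1 + t) ^ β ≤ C * Real.exp (ε * t) := by
  -- Raising $1+t\le k e^{t/k}$ to the power $|\beta|$ gives the exponent $|\beta|/k$, and $k$ is
  -- large enough for this to be at most $\varepsilon$.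
  set k : ℝ := 1 + |β| / ε with hk
  have hk0 : 0 ≤ |β| / ε := by positivity
  have hk1 : 1 ≤ k := by linarith
  refine ⟨k ^ |β|, by positivity, fun t ht => ?_⟩
  have h1 : 1 + t ≤ k * Real.exp (t / k) := by
    have := Real.add_one_le_exp (t / k)
    calc 1 + t ≤ k + t := by linarith
      _ = k * (t / k + 1) := by field_simp; ring
      _ ≤ _ := by gcongr
  calc (1 + t) ^ β ≤ (1 + t) ^ |β| :=
        Real.rpow_le_rpow_of_exponent_le (by linarith) (le_abs_self β)
    _ ≤ (k * Real.exp (t / k)) ^ |β| := by gcongr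
    _ = k ^ |β| * Real.exp (t / k * |β|) := by
        rw [Real.mul_rpow (by linarith) (Real.exp_pos _).le, ← Real.exp_mul]
    _ ≤ _ := by
        refine mul_le_mul_of_nonneg_left (Real.exp_le_exp.2 ?_) (by positivity)
        have hk2 : 0 < k := by linarith
        have : |β| ≤ ε * k := by
          rw [hk, mul_add, mul_div_cancel₀ _ hε.ne']
          linarith
        rw [div_mul_eq_mul_div, div_le_iff₀ hk2]
        nlinarith

theorem norm_one_add_cpow (b : ℂ) {t : ℝ} (ht : 0 ≤ t) :
    ‖((1 + t : ℝ) : ℂ) ^ b‖ = (1 + t) ^ b.re :=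
  Complex.norm_cpow_eq_rpow_re_of_pos (by linarith) b

theorem hasDerivAt_one_add_cpow (b : ℂ) {t : ℝ} (ht : 0 ≤ t) :
    HasDerivAt (fun t : ℝ => ((1 + t : ℝ) : ℂ) ^ b) (b * ((1 + t : ℝ) : ℂ) ^ (b - 1)) t := by
  have h0 : HasDerivAt (fun t : ℝ => ((1 + t : ℝ) : ℂ)) 1 t := by
    simpa using ((hasDerivAt_id t).const_add 1).ofReal_comp
  have h2 : ((1 + t : ℝ) : ℂ) ∈ Complex.slitPlane := Or.inl (by
    rw [Complex.ofReal_re]; linarith)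
  refine (((hasDerivAt_id ((1 + t : ℝ) : ℂ)).cpow_const (c := b) h2).comp t h0).congr_deriv ?_
  simp

theorem exists_norm_one_add_cpow_sub_one_le (b : ℂ) {ε : ℝ} (hε : 0 < ε) :
    ∃ C : ℝ, ∀ t : ℝ, 0 < t → ‖((1 + t : ℝ) : ℂ) ^ b - 1‖ ≤ C * (t * Real.exp (ε * t)) := by
  obtain ⟨C, hC0, hC⟩ := exists_one_add_rpow_le (b - 1).re hε
  refine ⟨‖b‖ * C, fun t ht => ?_⟩
  have := Convex.norm_image_sub_le_of_norm_hasDerivWithin_le (s := Icc 0 t) (x := 0) (y := t)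
    (f := fun t : ℝ => ((1 + t : ℝ) : ℂ) ^ b) (C := ‖b‖ * (C * Real.exp (ε * t)))
    (fun y hy => (hasDerivAt_one_add_cpow b hy.1).hasDerivWithinAt)
    (fun y hy => by
      rw [norm_mul, norm_one_add_cpow _ hy.1]
      gcongr
      refine (hC y hy.1).trans ?_
      gcongr
      exact hy.2) (convex_Icc _ _) (left_mem_Icc.2 ht.le) (right_mem_Icc.2 ht.le)
  simp only [add_zero, Complex.ofReal_one, Complex.one_cpow, sub_zero,
    Real.norm_of_nonneg ht.le] at this
  linarith

/-- The density in the integral representation of Tricomi's function. -/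
def tricomiDensity (a b : ℂ) (t : ℝ) : ℂ := (t : ℂ) ^ (a - 1) * ((1 + t : ℝ) : ℂ) ^ b

theorem measurable_cpow_one_add (b : ℂ) : Measurable fun t : ℝ => ((1 + t : ℝ) : ℂ) ^ b :=
  (Complex.measurable_ofReal.comp (measurable_const.add measurable_id)).pow_const b

theorem hasLaplaceBound_tricomiDensity (a b : ℂ) : HasLaplaceBound a.re (tricomiDensity a b) where
  meas := ((Complex.measurable_ofReal.pow_const _).mul
    (measurable_cpow_one_add b)).aestronglyMeasurable
  bound ε hε := by
    obtain ⟨C, hC0, hC⟩ := exists_one_add_rpow_le b.re hε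
    refine ⟨C, fun t ht => ?_⟩
    rw [tricomiDensity, norm_mul, norm_one_add_cpow _ ht.le,
      Complex.norm_cpow_eq_rpow_re_of_pos ht, Complex.sub_re, Complex.one_re]
    have : 0 ≤ t ^ (a.re - 1) := Real.rpow_nonneg ht.le _
    calc _ ≤ t ^ (a.re - 1) * (C * Real.exp (ε * t)) := by gcongr; exact hC t ht.le
      _ = _ := by ring

/-- Since $(1+t)^b-1$ vanishes to first order at $0$, removing the leading power gains a factor $t$,
hence a factor $x^{-1}$ after the transform. This is the error term in the normalization. -/
theorem hasLaplaceBound_tricomiDensity_sub (a b : ℂ) :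
    HasLaplaceBound (a.re + 1) (fun t : ℝ => tricomiDensity a b t - (t : ℂ) ^ (a - 1)) where
  meas := ((hasLaplaceBound_tricomiDensity a b).meas).sub
    (Complex.measurable_ofReal.pow_const _).aestronglyMeasurable
  bound ε hε := by
    obtain ⟨C, hC⟩ := exists_norm_one_add_cpow_sub_one_le b hε
    refine ⟨C, fun t ht => ?_⟩
    have h1 : tricomiDensity a b t - (t : ℂ) ^ (a - 1) =
        (t : ℂ) ^ (a - 1) * (((1 + t : ℝ) : ℂ) ^ b - 1) := by rw [tricomiDensity]; ring
    rw [h1, norm_mul, Complex.norm_cpow_eq_rpow_re_of_pos ht, Complex.sub_re, Complex.one_re]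
    have h2 : t ^ (a.re + 1 - 1) = t ^ (a.re - 1) * t := by
      rw [show a.re + 1 - 1 = (a.re - 1) + 1 by ring, Real.rpow_add ht, Real.rpow_one]
    have : 0 ≤ t ^ (a.re - 1) := Real.rpow_nonneg ht.le _
    calc _ ≤ t ^ (a.re - 1) * (C * (t * Real.exp (ε * t))) := by gcongr; exact hC t ht
      _ = _ := by rw [h2]; ring

theorem laplace_cpow {a : ℂ} (ha : 0 < a.re) {x : ℝ} (hx : 0 < x) :
    laplace (fun t : ℝ => (t : ℂ) ^ (a - 1)) x = Complex.Gamma a * (x : ℂ) ^ (-a) := by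
  have h := Complex.integral_cpow_mul_exp_neg_mul_Ioi ha (r := x) (by simpa using hx)
  rw [laplace]
  rw [show (fun t : ℝ => Complex.exp (-(x : ℂ) * t) * (t : ℂ) ^ (a - 1)) =
    fun t : ℝ => (t : ℂ) ^ (a - 1) * Complex.exp (-((x : ℂ) * t)) by
      funext t; rw [mul_comm, neg_mul], h, mul_comm, Complex.cpow_neg, one_div,
      Complex.inv_cpow]
  rw [Complex.arg_ofReal_of_nonneg hx.le]
  exact Real.pi_pos.ne

/-- The combined integrand is the exact derivative of $-e^{-xt}t^a(1+t)^{c-a}$, which vanishes at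
$0$ because $\operatorname{Re}a>0$ and at $\infty$ because $x>0$. -/
theorem laplace_tricomiDensity_ode {a c : ℂ} (ha : 0 < a.re) {x : ℝ} (hx : 0 < x) :
    (x : ℂ) * laplace (fun t => (t : ℂ) * ((t : ℂ) * tricomiDensity a (c - a - 1) t)) x +
      (c - x) * (-laplace (fun t => (t : ℂ) * tricomiDensity a (c - a - 1) t) x) -
      a * laplace (tricomiDensity a (c - a - 1)) x = 0 := by
  set p := tricomiDensity a (c - a - 1) with hp
  have hb := hasLaplaceBound_tricomiDensity a (c - a - 1)
  rw [← hp] at hb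
  have hxr : 0 < (x : ℂ).re := by simpa using hx
  have i0 := hb.integrableOn ha hxr
  have i1 := hb.mul_id.integrableOn (by linarith) hxr
  have i2 := hb.mul_id.mul_id.integrableOn (by linarith) hxr
  set G : ℝ → ℂ := fun t => -(Complex.exp (-(x : ℂ) * t) * ((t : ℂ) ^ a * ((1 + t : ℝ) : ℂ) ^ (c - a)))
    with hG
  have hlin : (fun t : ℝ => (x : ℂ) * (Complex.exp (-(x : ℂ) * t) * ((t : ℂ) * ((t : ℂ) * p t))) +
      (c - x) * (-(Complex.exp (-(x : ℂ) * t) * ((t : ℂ) * p t))) -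
      a * (Complex.exp (-(x : ℂ) * t) * p t)) = fun t : ℝ => Complex.exp (-(x : ℂ) * t) * p t *
        (x * t ^ 2 - (c - x) * t - a) := by
    funext t; ring
  have hder : ∀ t ∈ Ioi (0 : ℝ), HasDerivAt G (Complex.exp (-(x : ℂ) * t) * p t *
        (x * t ^ 2 - (c - x) * t - a)) t := by
    intro t ht
    have ht' : (0 : ℝ) < t := ht
    have htc : (t : ℂ) ≠ 0 := by exact_mod_cast ht'.ne'
    have ht1 : ((1 + t : ℝ) : ℂ) ≠ 0 := by exact_mod_cast (by linarith : (1 + t) ≠ 0)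
    have hid : HasDerivAt (fun t : ℝ => (t : ℂ)) 1 t := Complex.ofRealCLM.hasDerivAt
    have d1 := (hid.const_mul (-(x : ℂ))).cexp
    have d2 : HasDerivAt (fun t : ℝ => (t : ℂ) ^ a) (a * (t : ℂ) ^ (a - 1)) t :=
      (((hasDerivAt_id (t : ℂ)).cpow_const (c := a)
        (Or.inl (by simpa using ht'))).comp t hid).congr_deriv (by simp)
    have d3 := hasDerivAt_one_add_cpow (c - a) ht'.le
    refine (d1.mul (d2.mul d3)).neg.congr_deriv ?_
    have e1 : (t : ℂ) ^ a = (t : ℂ) ^ (a - 1) * t := by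
      rw [Complex.cpow_sub _ _ htc, Complex.cpow_one]; field_simp
    have e2 : ((1 + t : ℝ) : ℂ) ^ (c - a) = ((1 + t : ℝ) : ℂ) ^ (c - a - 1) * (1 + t) := by
      rw [Complex.cpow_sub _ 1 ht1, Complex.cpow_one]; field_simp; push_cast; ring
    simp only [Pi.mul_apply]
    rw [e1, e2, hp, tricomiDensity]
    ring
  have hzero : ContinuousWithinAt G (Ici 0) 0 := by
    have hc : Continuous fun t : ℝ => (t : ℂ) ^ a := Complex.continuous_ofReal_cpow_const ha
    have h1 : ContinuousAt (fun t : ℝ => ((1 + t : ℝ) : ℂ) ^ (c - a)) 0 :=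
      (hasDerivAt_one_add_cpow _ le_rfl).continuousAt
    have h2 : ContinuousAt (fun t : ℝ => Complex.exp (-(x : ℂ) * t)) 0 := by fun_prop
    exact ((h2.mul (hc.continuousAt.mul h1)).neg).continuousWithinAt
  have hinf : Tendsto G atTop (𝓝 0) := by
    -- The product $t^a(1+t)^{c-a}$ is itself a density of the same family, with $a+1$ in place of
    -- $a$.
    obtain ⟨C, hC⟩ := (hasLaplaceBound_tricomiDensity (a + 1) (c - a)).bound (x / 2) (by linarith)
    have hr : Tendsto (fun t : ℝ => C * (t ^ a.re * Real.exp (-(x / 2) * t))) atTop (𝓝 0) := by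
      simpa using (tendsto_rpow_mul_exp_neg_mul_atTop_nhds_zero a.re (x / 2)
        (by linarith)).const_mul C
    refine squeeze_zero_norm' ?_ hr
    filter_upwards [eventually_gt_atTop 0] with t ht
    have := norm_exp_mul_le hC (x : ℂ) ht
    rw [hG, norm_neg]
    simp only [tricomiDensity, add_sub_cancel_right, Complex.add_re, Complex.one_re,
      Complex.ofReal_re] at this
    convert this using 4
    ring
  have hint : IntegrableOn (fun t : ℝ => Complex.exp (-(x : ℂ) * t) * p t *
        (x * t ^ 2 - (c - x) * t - a)) (Ioi 0) := by
    rw [← hlin]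
    exact ((i2.const_mul _).add (i1.neg.const_mul _)).sub (i0.const_mul _)
  have hfin := integral_Ioi_of_hasDerivAt_of_tendsto hzero hder hint hinf
  have hG0 : G 0 = 0 := by
    have : a ≠ 0 := fun h => by simp [h] at ha
    simp [hG, this]
  rw [hG0, sub_zero, ← hlin] at hfin
  rw [← hfin, integral_sub, integral_add, integral_const_mul, integral_const_mul,
    integral_const_mul, integral_neg]
  · rfl
  · exact i2.const_mul _
  · exact i1.neg.const_mul _
  · exact (i2.const_mul _).add (i1.neg.const_mul _)
  · exact i0.const_mul _

end

noncomputable section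
open MeasureTheory Set Filter Asymptotics

/-! ## Existence and uniqueness of Tricomi's function -/

/-- The characterization of Tricomi's function, with a bound for the derivative in place of the
bound for the growth. -/
structure IsTricomiPsiStrong (a c : ℂ) (f : ℝ → ℂ) : Prop where
  analytic : AnalyticOnNhd ℝ f (Ioi 0)
  ode : ∀ x : ℝ, 0 < x → (x : ℂ) * deriv (deriv f) x + (c - x) * deriv f x - a * f x = 0
  normalized : (fun x : ℝ => f x - (x : ℂ) ^ (-a)) =O[atTop] fun x : ℝ => (x : ℂ) ^ (-a - 1)
  deriv_isBigO : deriv f =O[atTop] fun x : ℝ => (x : ℂ) ^ (-a - 1)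

theorem isBigO_cpow_of_re_le {a b : ℂ} (h : a.re ≤ b.re) :
    (fun x : ℝ => (x : ℂ) ^ a) =O[atTop] fun x : ℝ => (x : ℂ) ^ b := by
  refine IsBigO.of_bound 1 ?_
  filter_upwards [eventually_ge_atTop 1] with x hx
  have hx0 : 0 < x := by linarith
  rw [Complex.norm_cpow_eq_rpow_re_of_pos hx0, Complex.norm_cpow_eq_rpow_re_of_pos hx0, one_mul]
  exact Real.rpow_le_rpow_of_exponent_le hx h

theorem isBigO_cpow_rpow (a : ℂ) :
    (fun x : ℝ => x ^ a.re) =O[atTop] fun x : ℝ => (x : ℂ) ^ a := by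
  refine IsBigO.of_bound 1 ?_
  filter_upwards [eventually_gt_atTop 0] with x hx
  rw [Complex.norm_cpow_eq_rpow_re_of_pos hx, one_mul,
    Real.norm_of_nonneg (Real.rpow_nonneg hx.le _)]

theorem ofReal_mul_cpow (a : ℂ) {x : ℝ} (hx : 0 < x) : (x : ℂ) * (x : ℂ) ^ a = (x : ℂ) ^ (a + 1) := by
  rw [Complex.cpow_add _ _ (by exact_mod_cast hx.ne'), Complex.cpow_one, mul_comm]

theorem IsTricomiPsiStrong.isBigO {a c : ℂ} {f : ℝ → ℂ} (h : IsTricomiPsiStrong a c f) :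
    f =O[atTop] fun x : ℝ => (x : ℂ) ^ (-a) := by
  have h1 := (h.normalized.trans (isBigO_cpow_of_re_le (a := -a - 1) (b := -a) (by simp))).add
    (isBigO_refl (fun x : ℝ => (x : ℂ) ^ (-a)) atTop)
  simpa using h1

theorem hasDerivAt_ofReal (x : ℝ) : HasDerivAt (fun x : ℝ => (x : ℂ)) 1 x :=
  Complex.ofRealCLM.hasDerivAt

/-- The contiguous relation lowering both parameters by one. -/
theorem IsTricomiPsiStrong.lower {a c : ℂ} {f : ℝ → ℂ} (h : IsTricomiPsiStrong a c f) :
    IsTricomiPsiStrong (a - 1) (c - 1) (fun x : ℝ => ((x : ℂ) + 1 - c) * f x - x * deriv f x) := by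
  have hid : AnalyticOnNhd ℝ (fun x : ℝ => (x : ℂ)) (Ioi 0) :=
    fun x _ => Complex.ofRealCLM.analyticAt x
  -- The equation for $f$ collapses this derivative to $(1-a)f$; both the new equation and the new
  -- derivative bound follow from that.
  have hd : ∀ x : ℝ, 0 < x → HasDerivAt (fun x : ℝ => ((x : ℂ) + 1 - c) * f x - x * deriv f x)
      ((1 - a) * f x) x := by
    intro x hx
    have d0 := (h.analytic x hx).differentiableAt.hasDerivAt
    have d1 := (h.analytic.deriv x hx).differentiableAt.hasDerivAt
    refine (((((hasDerivAt_ofReal x).add_const 1).sub_const c).mul d0).sub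
      ((hasDerivAt_ofReal x).mul d1)).congr_deriv ?_
    linear_combination -h.ode x hx
  have hev : ∀ x : ℝ, 0 < x → deriv (fun x : ℝ => ((x : ℂ) + 1 - c) * f x - x * deriv f x) =ᶠ[𝓝 x]
      fun x => (1 - a) * f x := by
    intro x hx
    filter_upwards [lt_mem_nhds hx] with y hy using (hd y hy).deriv
  have hev' : deriv (fun x : ℝ => ((x : ℂ) + 1 - c) * f x - x * deriv f x) =ᶠ[atTop]
      fun x => (1 - a) * f x := by
    filter_upwards [eventually_gt_atTop 0] with y hy using (hd y hy).deriv
  refine ⟨?_, ?_, ?_, ?_⟩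
  · exact (((hid.add analyticOnNhd_const).sub analyticOnNhd_const).mul h.analytic).sub
      (hid.mul h.analytic.deriv)
  · intro x hx
    rw [(hev x hx).deriv_eq, (hd x hx).deriv, deriv_const_mul_field]
    ring
  · have e : -(a - 1) - 1 = -a := by ring
    rw [e]
    have h1 : (fun x : ℝ => (x : ℂ) * (f x - (x : ℂ) ^ (-a)) + (1 - c) * f x - x * deriv f x)
        =O[atTop] fun x : ℝ => (x : ℂ) ^ (-a) := by
      have hx : ∀ g : ℝ → ℂ, g =O[atTop] (fun x : ℝ => (x : ℂ) ^ (-a - 1)) →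
          (fun x : ℝ => (x : ℂ) * g x) =O[atTop] fun x : ℝ => (x : ℂ) ^ (-a) := by
        intro g hg
        refine ((isBigO_refl (fun x : ℝ => (x : ℂ)) atTop).mul hg).congr' EventuallyEq.rfl ?_
        filter_upwards [eventually_gt_atTop 0] with x hx
        rw [ofReal_mul_cpow _ hx, sub_add_cancel]
      exact ((hx _ h.normalized).add (h.isBigO.const_mul_left (1 - c))).sub
        (hx _ h.deriv_isBigO)
    refine h1.congr' ?_ EventuallyEq.rfl
    filter_upwards [eventually_gt_atTop 0] with x hx
    have := ofReal_mul_cpow (-a) hx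
    rw [show -a + 1 = -(a - 1) by ring] at this
    rw [← this]
    ring
  · rw [show -(a - 1) - 1 = -a by ring]
    exact (h.isBigO.const_mul_left (1 - a)).congr' hev'.symm EventuallyEq.rfl

theorem isTricomiPsiStrong_laplace {a : ℂ} (c : ℂ) (ha : 0 < a.re) :
    IsTricomiPsiStrong a c
      (fun x : ℝ => (Complex.Gamma a)⁻¹ * laplace (tricomiDensity a (c - a - 1)) x) := by
  have hb := hasLaplaceBound_tricomiDensity a (c - a - 1)
  have hs := hasLaplaceBound_tricomiDensity_sub a (c - a - 1)
  have ha1 : 0 < a.re + 1 := by linarith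
  have hG : Complex.Gamma a ≠ 0 := Complex.Gamma_ne_zero_of_re_pos ha
  set p := tricomiDensity a (c - a - 1)
  set γ := (Complex.Gamma a)⁻¹
  have d1 : ∀ x : ℝ, 0 < x → HasDerivAt (fun x : ℝ => γ * laplace p x)
      (γ * -laplace (fun t => (t : ℂ) * p t) x) x :=
    fun x hx => (hb.hasDerivAt_ofReal ha hx).const_mul γ
  have d2 : ∀ x : ℝ, 0 < x → HasDerivAt (fun x : ℝ => γ * -laplace (fun t => (t : ℂ) * p t) x)
      (γ * laplace (fun t => (t : ℂ) * ((t : ℂ) * p t)) x) x := by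
    intro x hx
    have := ((hb.mul_id.hasDerivAt_ofReal ha1 hx).fun_neg).const_mul γ
    rwa [neg_neg] at this
  have hexp : (fun x : ℝ => x ^ (-(a.re + 1))) =O[atTop] fun x : ℝ => (x : ℂ) ^ (-a - 1) := by
    have := isBigO_cpow_rpow (-a - 1)
    rwa [show (-a - 1).re = -(a.re + 1) by simp; ring] at this
  refine ⟨?_, ?_, ?_, ?_⟩
  · exact analyticOnNhd_const.mul (hb.analyticOnNhd ha)
  · intro x hx
    have hev : deriv (fun x : ℝ => γ * laplace p x) =ᶠ[𝓝 x]
        fun x : ℝ => γ * -laplace (fun t => (t : ℂ) * p t) x := by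
      filter_upwards [lt_mem_nhds hx] with y hy using (d1 y hy).deriv
    rw [hev.deriv_eq, (d2 x hx).deriv, (d1 x hx).deriv]
    linear_combination γ * laplace_tricomiDensity_ode (c := c) ha hx
  · refine (((hs.isBigO ha1).trans hexp).const_mul_left γ).congr' ?_ EventuallyEq.rfl
    filter_upwards [eventually_gt_atTop 0] with x hx
    have hxr : 0 < (x : ℂ).re := by simpa using hx
    have i1 := hb.integrableOn ha hxr
    have i2 := hs.integrableOn ha1 hxr
    have h3 : laplace (fun t : ℝ => (t : ℂ) ^ (a - 1)) x =
        laplace p x - laplace (fun t : ℝ => p t - (t : ℂ) ^ (a - 1)) x := by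
      rw [laplace, laplace, laplace, ← integral_sub i1 i2]
      congr 1
      funext t
      ring
    rw [laplace_cpow ha hx] at h3
    have h4 : γ * Complex.Gamma a = 1 := inv_mul_cancel₀ hG
    linear_combination γ * h3 - (x : ℂ) ^ (-a) * h4
  · refine ((((hb.mul_id.isBigO ha1).trans hexp).neg_left).const_mul_left γ).congr' ?_
      EventuallyEq.rfl
    filter_upwards [eventually_gt_atTop 0] with x hx using (d1 x hx).deriv.symm

/-- Induction on a natural number exceeding $-\operatorname{Re}a$: the integral serves as the base,
and `lower` descends from $(a+1,c+1)$ to $(a,c)$. -/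
theorem exists_isTricomiPsiStrong (a c : ℂ) : ∃ f, IsTricomiPsiStrong a c f := by
  obtain ⟨n, hn⟩ := exists_nat_gt (-a.re)
  have key : ∀ n : ℕ, ∀ a c : ℂ, -a.re < n → ∃ f, IsTricomiPsiStrong a c f := by
    intro n
    induction n with
    | zero => exact fun a c h => ⟨_, isTricomiPsiStrong_laplace c (by simpa using h)⟩
    | succ n ih =>
      intro a c h
      obtain ⟨f, hf⟩ := ih (a + 1) (c + 1) (by push_cast at h; simp; linarith)
      have := hf.lower
      rw [add_sub_cancel_right, add_sub_cancel_right] at this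
      exact ⟨_, this⟩
  exact key n a c hn

theorem exists_isBigO_pow (a : ℂ) :
    ∃ N : ℕ, (fun x : ℝ => (x : ℂ) ^ a) =O[atTop] fun x : ℝ => x ^ N := by
  obtain ⟨N, hN⟩ := exists_nat_ge a.re
  refine ⟨N, IsBigO.of_bound 1 ?_⟩
  filter_upwards [eventually_ge_atTop 1] with x hx
  have hx0 : 0 < x := by linarith
  rw [Complex.norm_cpow_eq_rpow_re_of_pos hx0, one_mul, norm_pow, Real.norm_of_nonneg hx0.le,
    ← Real.rpow_natCast]
  exact Real.rpow_le_rpow_of_exponent_le hx hN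

theorem IsTricomiPsiStrong.isTricomiPsi {a c : ℂ} {f : ℝ → ℂ} (h : IsTricomiPsiStrong a c f) :
    IsTricomiPsi a c f where
  analytic := h.analytic
  ode x hx := by
    rw [iteratedDeriv_succ, iteratedDeriv_one]
    exact h.ode x hx
  growth := by
    obtain ⟨N, hN⟩ := exists_isBigO_pow (-a)
    exact ⟨N, h.isBigO.trans hN⟩
  normalized := h.normalized

/-! ### Wronskians and uniqueness -/

/-- Analytic functions on `(0, ∞)` with vanishing Wronskian are proportional. -/
theorem exists_eq_mul_of_wronskian {f g : ℝ → ℂ} (hf : AnalyticOnNhd ℝ f (Ioi 0))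
    (hg : AnalyticOnNhd ℝ g (Ioi 0)) {x₀ : ℝ} (hx₀ : 0 < x₀) (h0 : g x₀ ≠ 0)
    (hW : ∀ x : ℝ, 0 < x → deriv f x * g x = f x * deriv g x) :
    ∃ k : ℂ, ∀ x : ℝ, 0 < x → f x = k * g x := by
  refine ⟨f x₀ / g x₀, ?_⟩
  -- The quotient $f/g$ is constant only where $g\ne0$, so the argument is local at $x_0$; the
  -- identity theorem then crosses the zeros of $g$.
  have hne : ∀ᶠ x in 𝓝 x₀, g x ≠ 0 := (hg x₀ hx₀).continuousAt.eventually_ne h0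
  obtain ⟨ε, hε, hball⟩ := Metric.eventually_nhds_iff_ball.1 (hne.and (lt_mem_nhds hx₀))
  have hd : ∀ x ∈ Metric.ball x₀ ε, HasDerivAt (fun x => f x / g x) 0 x := by
    intro x hx
    obtain ⟨h1, h2⟩ := hball x hx
    refine ((hf x h2).differentiableAt.hasDerivAt.div (hg x h2).differentiableAt.hasDerivAt
      h1).congr_deriv ?_
    rw [hW x h2, sub_self, zero_div]
  have hconst : ∀ x ∈ Metric.ball x₀ ε, f x / g x = f x₀ / g x₀ := by
    intro x hx
    exact (convex_ball x₀ ε).is_const_of_fderivWithin_eq_zero (𝕜 := ℝ) (f := fun x => f x / g x)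
      (fun y hy => (hd y hy).differentiableAt.differentiableWithinAt)
      (fun y hy => by
        rw [fderivWithin_of_isOpen Metric.isOpen_ball hy]
        ext
        simpa using (hd y hy).deriv) hx (Metric.mem_ball_self hε)
  have hev : f =ᶠ[𝓝 x₀] fun x => f x₀ / g x₀ * g x := by
    filter_upwards [Metric.ball_mem_nhds x₀ hε] with x hx
    rw [← hconst x hx, div_mul_cancel₀ _ (hball x hx).1]
  exact fun x hx => hf.eqOn_of_preconnected_of_eventuallyEq (analyticOnNhd_const.mul hg)
    isPreconnected_Ioi hx₀ hev hx

/-- A function tending to zero has no derivative with nonzero limit. -/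
theorem eq_zero_of_tendsto_deriv {r r' : ℝ → ℂ} {K : ℂ} (hr : Tendsto r atTop (𝓝 0))
    (hd : ∀ x : ℝ, 0 < x → HasDerivAt r (r' x) x) (hr' : Tendsto r' atTop (𝓝 K)) : K = 0 := by
  by_contra hK
  have hK' : 0 < ‖K‖ := norm_pos_iff.2 hK
  obtain ⟨A, hA⟩ := eventually_atTop.1 ((Metric.tendsto_nhds.1 hr' (‖K‖ / 2) (by linarith)).and
    ((Metric.tendsto_nhds.1 hr (‖K‖ / 8) (by linarith)).and (eventually_gt_atTop 0)))
  -- The mean value inequality for $r(x)-xK$ on a unit interval gives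
  -- $\|K\|\le\frac12\|K\|+\frac14\|K\|$ up to strictness, a contradiction.
  have h1 := Convex.norm_image_sub_le_of_norm_hasDerivWithin_le (s := Icc A (A + 1))
    (f := fun x : ℝ => r x - x * K) (f' := fun x => r' x - 1 * K) (C := ‖K‖ / 2) (x := A) (y := A + 1)
    (fun x hx => ((hd x (hA x hx.1).2.2).sub
      ((hasDerivAt_ofReal x).mul_const K)).hasDerivWithinAt)
    (fun x hx => by
      have := (hA x hx.1).1
      rw [dist_eq_norm] at this
      simpa using this.le) (convex_Icc _ _) (left_mem_Icc.2 (by linarith))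
      (right_mem_Icc.2 (by linarith))
  have h2 := (hA A le_rfl).2.1
  have h3 := (hA (A + 1) (by linarith)).2.1
  rw [dist_zero_right] at h2 h3
  have h4 : K = (r (A + 1) - r A) - (r (A + 1) - ((A + 1 : ℝ) : ℂ) * K - (r A - (A : ℂ) * K)) := by
    push_cast
    ring
  have h5 := norm_sub_le (r (A + 1) - r A)
    (r (A + 1) - ((A + 1 : ℝ) : ℂ) * K - (r A - (A : ℂ) * K))
  rw [← h4] at h5
  have h6 := norm_sub_le (r (A + 1)) (r A)
  simp only [add_sub_cancel_left, norm_one, mul_one] at h1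
  linarith

theorem tendsto_pow_mul_cpow_mul_exp (N : ℕ) (c : ℂ) {b : ℝ} (hb : 0 < b) {g : ℝ → ℂ}
    (hg : g =O[atTop] fun x : ℝ => x ^ N) :
    Tendsto (fun x : ℝ => (x : ℂ) ^ c * Complex.exp (-(b * x : ℝ)) * g x) atTop (𝓝 0) := by
  have h1 : Tendsto (fun x : ℝ => x ^ (c.re + N) * Real.exp (-b * x)) atTop (𝓝 0) :=
    tendsto_rpow_mul_exp_neg_mul_atTop_nhds_zero _ _ hb
  obtain ⟨C, hC⟩ := hg.bound
  refine IsBigO.trans_tendsto (IsBigO.of_bound C ?_) h1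
  filter_upwards [hC, eventually_gt_atTop 0] with x hC hx
  have h2 : 0 ≤ x ^ c.re := Real.rpow_nonneg hx.le _
  rw [norm_mul, norm_mul, Complex.norm_cpow_eq_rpow_re_of_pos hx, norm_mul,
    Real.norm_of_nonneg (Real.rpow_nonneg hx.le _), Real.norm_of_nonneg (Real.exp_pos _).le,
    Complex.norm_exp, Real.rpow_add hx, Real.rpow_natCast]
  rw [norm_pow, Real.norm_of_nonneg hx.le] at hC
  have h3 : (-((b * x : ℝ) : ℂ)).re = -b * x := by simp
  rw [h3]
  calc x ^ c.re * Real.exp (-b * x) * ‖g x‖ ≤ x ^ c.re * Real.exp (-b * x) * (C * x ^ N) := by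
        gcongr
    _ = _ := by ring

theorem hasDerivAt_ofReal_cpow (c : ℂ) {x : ℝ} (hx : 0 < x) :
    HasDerivAt (fun x : ℝ => (x : ℂ) ^ c) (c * (x : ℂ) ^ (c - 1)) x :=
  (((hasDerivAt_id (x : ℂ)).cpow_const (c := c)
    (Or.inl (by simpa using hx))).comp x (hasDerivAt_ofReal x)).congr_deriv (by simp)

theorem hasDerivAt_exp_neg_mul (b x : ℝ) :
    HasDerivAt (fun x : ℝ => Complex.exp (-(b * x : ℝ))) (-b * Complex.exp (-(b * x : ℝ))) x := by
  have h := ((((hasDerivAt_id x).const_mul b).ofReal_comp).neg).cexp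
  refine h.congr_deriv ?_
  simp
  ring

/-- The Wronskian of a polynomially bounded solution and Tricomi's function vanishes. -/
theorem IsTricomiPsiStrong.wronskian {a c : ℂ} {f g : ℝ → ℂ} (hg : IsTricomiPsiStrong a c g)
    (hf : IsTricomiPsi a c f) {x : ℝ} (hx : 0 < x) : deriv f x * g x = f x * deriv g x := by
  set E : ℝ → ℂ := fun x => (x : ℂ) ^ c * Complex.exp (-(1 * x : ℝ)) with hE
  have hE0 : ∀ x : ℝ, 0 < x → E x ≠ 0 := fun x hx => by
    have hx' : (x : ℂ) ≠ 0 := by exact_mod_cast hx.ne'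
    simp [hE, Complex.cpow_eq_zero_iff, hx']
  have hcx : ∀ x : ℝ, 0 < x → (x : ℂ) * (x : ℂ) ^ (c - 1) = (x : ℂ) ^ c := fun x hx => by
    rw [ofReal_mul_cpow _ hx, sub_add_cancel]
  have dE : ∀ x : ℝ, 0 < x → HasDerivAt E (c * ((x : ℂ) ^ (c - 1) * Complex.exp (-(1 * x : ℝ))) - E x) x := by
    intro x hx
    refine ((hasDerivAt_ofReal_cpow c hx).mul (hasDerivAt_exp_neg_mul 1 x)).congr_deriv ?_
    simp only [hE]
    push_cast
    ring
  have hode : ∀ x : ℝ, 0 < x →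
      (x : ℂ) * deriv (deriv f) x + (c - x) * deriv f x - a * f x = 0 := by
    intro x hx
    have := hf.ode x hx
    rwa [iteratedDeriv_succ, iteratedDeriv_one] at this
  have df : ∀ x : ℝ, 0 < x → HasDerivAt f (deriv f x) x :=
    fun x hx => (hf.analytic x hx).differentiableAt.hasDerivAt
  have dg : ∀ x : ℝ, 0 < x → HasDerivAt g (deriv g x) x :=
    fun x hx => (hg.analytic x hx).differentiableAt.hasDerivAt
  have ddf : ∀ x : ℝ, 0 < x → HasDerivAt (deriv f) (deriv (deriv f) x) x :=
    fun x hx => (hf.analytic.deriv x hx).differentiableAt.hasDerivAt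
  have ddg : ∀ x : ℝ, 0 < x → HasDerivAt (deriv g) (deriv (deriv g) x) x :=
    fun x hx => (hg.analytic.deriv x hx).differentiableAt.hasDerivAt
  -- Abel's identity: $x^ce^{-x}$ is the integrating factor that makes the Wronskian constant.
  have dk : ∀ x : ℝ, 0 < x →
      HasDerivAt (fun x => E x * (deriv f x * g x - f x * deriv g x)) 0 x := by
    intro x hx
    refine ((dE x hx).mul (((ddf x hx).mul (dg x hx)).sub
      ((df x hx).mul (ddg x hx)))).congr_deriv ?_
    have hx' : (x : ℂ) ≠ 0 := by exact_mod_cast hx.ne'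
    refine mul_left_cancel₀ hx' ?_
    simp only [Pi.mul_apply, Pi.sub_apply, hE]
    rw [← hcx x hx]
    linear_combination (x : ℂ) * (x : ℂ) ^ (c - 1) * Complex.exp (-(1 * x : ℝ)) *
      (g x * hode x hx - f x * hg.ode x hx)
  have hconst : ∀ y : ℝ, 0 < y → E y * (deriv f y * g y - f y * deriv g y) =
      E x * (deriv f x * g x - f x * deriv g x) := fun y hy =>
    isOpen_Ioi.is_const_of_deriv_eq_zero (𝕜 := ℝ)
      (f := fun x => E x * (deriv f x * g x - f x * deriv g x)) isPreconnected_Ioi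
      (fun z hz => (dk z hz).differentiableAt.differentiableWithinAt)
      (fun z hz => (dk z hz).deriv) hy hx
  set K := E x * (deriv f x * g x - f x * deriv g x) with hK
  obtain ⟨N, hN⟩ := hf.growth
  obtain ⟨N₁, hN₁⟩ := exists_isBigO_pow (-a)
  obtain ⟨N₂, hN₂⟩ := exists_isBigO_pow (-a - 1)
  have b1 : (fun x => f x * g x) =O[atTop] fun x : ℝ => x ^ (N + N₁) := by
    simpa only [pow_add] using hN.mul (hg.isBigO.trans hN₁)
  have b2 : (fun x => f x * deriv g x) =O[atTop] fun x : ℝ => x ^ (N + N₂) := by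
    simpa only [pow_add] using hN.mul (hg.deriv_isBigO.trans hN₂)
  have t1 := tendsto_pow_mul_cpow_mul_exp _ c one_pos b1
  have t2 := tendsto_pow_mul_cpow_mul_exp _ c one_pos b2
  have t3 := tendsto_pow_mul_cpow_mul_exp _ (c - 1) one_pos b1
  have hlim := ((tendsto_const_nhds (x := K)).add (t2.const_mul 2)).add
    ((t3.const_mul c).sub t1)
  -- No bound on $f'$ is available, so $Ef'g$ is replaced by $K+Efg'$. All terms but $K$ then decay,
  -- and so does $Efg$, which forces $K=0$.
  have hder : ∀ y : ℝ, 0 < y → HasDerivAt (fun y : ℝ => E y * (f y * g y))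
      (K + 2 * ((y : ℂ) ^ c * Complex.exp (-(1 * y : ℝ)) * (f y * deriv g y)) +
        (c * ((y : ℂ) ^ (c - 1) * Complex.exp (-(1 * y : ℝ)) * (f y * g y)) -
          (y : ℂ) ^ c * Complex.exp (-(1 * y : ℝ)) * (f y * g y))) y := by
    intro y hy
    refine ((dE y hy).mul ((df y hy).mul (dg y hy))).congr_deriv ?_
    rw [← hconst y hy]
    simp only [Pi.mul_apply, hE]
    ring
  have hK0 : K = 0 := eq_zero_of_tendsto_deriv t1 hder (by simpa using hlim)
  exact sub_eq_zero.1 ((mul_eq_zero.1 (hK.symm.trans hK0)).resolve_left (hE0 x hx))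

theorem not_isBigO_cpow (a : ℂ) {k : ℂ} (h : (fun x : ℝ => k * (x : ℂ) ^ (-a)) =O[atTop]
    fun x : ℝ => (x : ℂ) ^ (-a - 1)) : k = 0 := by
  have h1 := (isBigO_refl (fun x : ℝ => (x : ℂ) ^ a) atTop).mul h
  have h2 : (fun _ : ℝ => k) =O[atTop] fun x : ℝ => x⁻¹ := by
    refine (h1.congr' ?_ EventuallyEq.rfl).trans ?_
    · filter_upwards [eventually_gt_atTop 0] with x hx
      have hx' : (x : ℂ) ≠ 0 := by exact_mod_cast hx.ne'
      rw [mul_left_comm, ← Complex.cpow_add _ _ hx', add_neg_cancel, Complex.cpow_zero, mul_one]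
    · refine IsBigO.of_bound 1 ?_
      filter_upwards [eventually_gt_atTop 0] with x hx
      have hx' : (x : ℂ) ≠ 0 := by exact_mod_cast hx.ne'
      rw [← Complex.cpow_add _ _ hx', show a + (-a - 1) = -1 by ring, Complex.cpow_neg_one]
      simp
  exact tendsto_nhds_unique tendsto_const_nhds (h2.trans_tendsto tendsto_inv_atTop_zero)

theorem IsTricomiPsi.exists_ne_zero {a c : ℂ} {g : ℝ → ℂ} (hg : IsTricomiPsi a c g) :
    ∃ x : ℝ, 0 < x ∧ g x ≠ 0 := by
  by_contra! h
  have h1 : (fun x : ℝ => (-1) * (x : ℂ) ^ (-a)) =O[atTop] fun x : ℝ => (x : ℂ) ^ (-a - 1) := by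
    refine hg.normalized.congr' ?_ EventuallyEq.rfl
    filter_upwards [eventually_gt_atTop 0] with x hx
    rw [h x hx]
    ring
  simpa using not_isBigO_cpow a h1

/-- Uniqueness of Tricomi's function. -/
theorem IsTricomiPsi.eq_strong {a c : ℂ} {f g : ℝ → ℂ} (hf : IsTricomiPsi a c f)
    (hg : IsTricomiPsiStrong a c g) {x : ℝ} (hx : 0 < x) : f x = g x := by
  obtain ⟨x₀, hx₀, h0⟩ := IsTricomiPsi.exists_ne_zero hg.isTricomiPsi
  obtain ⟨k, hk⟩ := exists_eq_mul_of_wronskian hf.analytic hg.analytic hx₀ h0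
    (fun x hx => hg.wronskian hf hx)
  have h1 : (fun x : ℝ => (k - 1) * (x : ℂ) ^ (-a)) =O[atTop] fun x : ℝ => (x : ℂ) ^ (-a - 1) := by
    refine (hf.normalized.sub (hg.normalized.const_mul_left k)).congr' ?_ EventuallyEq.rfl
    filter_upwards [eventually_gt_atTop 0] with x hx
    rw [hk x hx]
    ring
  have h2 : k = 1 := sub_eq_zero.1 (not_isBigO_cpow a h1)
  rw [hk x hx, h2, one_mul]

/-- Uniqueness transfers the derivative bound to the function picked by choice, so later arguments
may work with $f$. -/
theorem exists_strong_eq_tricomiPsi (a c : ℂ) :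
    ∃ f, IsTricomiPsiStrong a c f ∧ ∀ x : ℝ, 0 < x → tricomiPsi a c x = f x := by
  obtain ⟨f, hf⟩ := exists_isTricomiPsiStrong a c
  have h : ∃ f, IsTricomiPsi a c f := ⟨f, hf.isTricomiPsi⟩
  refine ⟨f, hf, fun x hx => ?_⟩
  rw [tricomiPsi, dif_pos h]
  exact h.choose_spec.eq_strong hf hx

end

noncomputable section

/-! ## The operators form a representation of the QISM II algebra -/

theorem rapidSpace_ext {f g : rapidSpace} (h : ∀ x : ℝ, 0 < x → f.1 x = g.1 x) : f = g := by
  apply Subtype.ext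
  funext x
  rcases le_or_gt x 0 with hx | hx
  · rw [IsRapid.zero f.2 x hx, IsRapid.zero g.2 x hx]
  · exact h x hx

theorem opX_mul_opXinv : opX * opXinv = 1 := by
  refine LinearMap.ext fun f => rapidSpace_ext fun x hx => ?_
  have hx' : (x : ℂ) ≠ 0 := by exact_mod_cast hx.ne'
  exact mul_inv_cancel_left₀ hx' _

theorem opXinv_mul_opX : opXinv * opX = 1 := by
  refine LinearMap.ext fun f => rapidSpace_ext fun x hx => ?_
  have hx' : (x : ℂ) ≠ 0 := by exact_mod_cast hx.ne'
  exact inv_mul_cancel_left₀ hx' _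

theorem opD_mul_opX : opD * opX = opX * opD + 1 := by
  refine LinearMap.ext fun f => rapidSpace_ext fun x hx => ?_
  have h1 : HasDerivAt (fun x : ℝ => (x : ℂ)) 1 x := Complex.ofRealCLM.hasDerivAt
  have h2 := (h1.mul (IsRapid.analytic f.2 x hx).differentiableAt.hasDerivAt).deriv
  refine h2.trans ?_
  change _ = (x : ℂ) * deriv f.1 x + f.1 x
  ring

/-- Multiplication `x`, its inverse and the derivative, abstractly. -/
structure IsWeylTriple {𝒜 : Type*} [Ring 𝒜] (X Y D : 𝒜) : Prop where
  mul_inv : X * Y = 1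
  inv_mul : Y * X = 1
  comm : D * X = X * D + 1

/-- The relations between `Y = x⁻¹`, `D = ∂ₓ` and `C = C(0)`. -/
structure IsShiftTriple {𝒜 : Type*} [Ring 𝒜] [Algebra ℂ 𝒜] (δ : ℂ) (Y D C : 𝒜) : Prop where
  d_y : D * Y = Y * D - Y * Y
  c_y : C * Y = Y * C + (2 : ℂ) • D - Y
  c_d : C * D = D * C - (2 : ℂ) • (Y * C) - D + (2 * δ) • (1 : 𝒜)
  d_d : D * D = -(Y * (Y * C)) - Y * D + (1 / 4 : ℂ) • (1 : 𝒜) + (2 * δ) • Y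

/-- The Weyl relation conjugated by $Y$ gives the commutation of $D$ with $Y$; the rest is
reordering with $D$ moved to the right. The formula for $D^2$ is the definition of $C$ multiplied by
$Y^2$ and solved for $D^2$. -/
theorem IsWeylTriple.isShiftTriple {𝒜 : Type*} [Ring 𝒜] [Algebra ℂ 𝒜] {X Y D : 𝒜}
    (h : IsWeylTriple X Y D) (δ : ℂ) : IsShiftTriple δ Y D
      (-(X ^ 2 * D ^ 2) - X * D + (1 / 4 : ℂ) • X ^ 2 + (2 * δ) • X) := by
  have xy (z : 𝒜) : X * (Y * z) = z := by rw [← mul_assoc, h.mul_inv, one_mul]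
  have yx (z : 𝒜) : Y * (X * z) = z := by rw [← mul_assoc, h.inv_mul, one_mul]
  have dx (z : 𝒜) : D * (X * z) = X * (D * z) + z := by
    rw [← mul_assoc, h.comm, add_mul, one_mul, mul_assoc]
  have hdy : D * Y = Y * D - Y * Y := by
    have e : Y * (D * X) * Y = Y * (X * D + 1) * Y := by rw [h.comm]
    simp only [mul_add, add_mul, mul_one, mul_assoc, yx, h.mul_inv] at e
    rw [e]
    abel
  have dy (z : 𝒜) : D * (Y * z) = Y * (D * z) - Y * (Y * z) := by
    rw [← mul_assoc, hdy, sub_mul, mul_assoc, mul_assoc]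
  constructor
  · exact hdy
  all_goals
    simp only [pow_two, add_mul, mul_add, sub_mul, mul_sub, neg_mul, mul_neg, smul_mul_assoc,
      mul_smul_comm, mul_assoc, h.comm, dx, hdy, dy, xy, yx, h.mul_inv, h.inv_mul, mul_one]
    module

set_option maxHeartbeats 4000000 in
-- Both sides are brought to the normal form $Y^iD^\varepsilon C^j$; equality of coefficients uses
-- only `hu` and `hv`. Writing $\kappa,\eta$ for the quotients avoids any division.
theorem IsShiftTriple.reflection {𝒜 : Type*} [Ring 𝒜] [Algebra ℂ 𝒜] {δ : ℂ} {Y D C : 𝒜}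
    (h : IsShiftTriple δ Y D C) {u v κ η : ℂ} (hu : κ * (u - 1 / 2) = δ)
    (hv : η * (v - 1 / 2) = δ) (M N : Matrix (Fin 2) (Fin 2) 𝒜)
    (hM : M = !![u • Y + D + κ • 1, Y ^ 2; C + (u ^ 2) • 1, (u + 1) • Y - D + κ • 1])
    (hN : N = !![v • Y + D + η • 1, Y ^ 2; C + (v ^ 2) • 1, (v + 1) • Y - D + η • 1]) :
    reflectionLeft u v M N = reflectionRight u v M N := by
  have dy (z : 𝒜) : D * (Y * z) = Y * (D * z) - Y * (Y * z) := by
    rw [← mul_assoc, h.d_y, sub_mul, mul_assoc, mul_assoc]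
  have cy (z : 𝒜) : C * (Y * z) = Y * (C * z) + (2 : ℂ) • (D * z) - Y * z := by
    rw [← mul_assoc, h.c_y, sub_mul, add_mul, mul_assoc, smul_mul_assoc]
  have hd := h.d_y
  have hcy := h.c_y
  have hcd := h.c_d
  have hdd := h.d_d
  ext p q : 1
  obtain ⟨p1, p2⟩ := p
  obtain ⟨q1, q2⟩ := q
  simp only [reflectionLeft, reflectionRight, rMatrix, firstLeg, secondLeg, Matrix.mul_apply,
    Fintype.sum_prod_type, Fin.sum_univ_two, Matrix.add_apply, Matrix.smul_apply,
    Matrix.kroneckerMap_apply, Matrix.of_apply, Matrix.one_apply, Prod.mk.injEq]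
  fin_cases p1 <;> fin_cases p2 <;> fin_cases q1 <;> fin_cases q2 <;>
  simp only [Fin.zero_eta, Fin.mk_one, Fin.isValue, one_ne_zero, zero_ne_one, and_self, and_true,
    and_false, if_true, if_false, smul_zero, add_zero,
    zero_add, mul_zero, zero_mul, mul_one, one_mul, smul_mul_assoc, mul_smul_comm, add_mul,
    mul_add] <;>
  rw [hM, hN] <;>
  simp only [Matrix.of_apply, Matrix.cons_val', Matrix.cons_val_zero, Matrix.cons_val_one,
    Matrix.cons_val_fin_one, pow_two, add_mul, mul_add, sub_mul, mul_sub,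
    smul_mul_assoc, mul_smul_comm, mul_assoc, mul_one, one_mul, dy, cy, hd, hcy, hcd, hdd] <;>
  match_scalars <;> grind

theorem isShiftTriple_op (δ : ℂ) : IsShiftTriple δ opXinv opD (opC δ 0) := by
  have h : IsWeylTriple opX opXinv opD := ⟨opX_mul_opXinv, opXinv_mul_opX, opD_mul_opX⟩
  have e : opC δ 0 = -(opX ^ 2 * opD ^ 2) - opX * opD + (1 / 4 : ℂ) • opX ^ 2 + (2 * δ) • opX := by
    rw [opC]; simp
  rw [e]
  exact h.isShiftTriple δ

theorem opA_eq (δ u : ℂ) : opA δ u = u • opXinv + opD + (δ / (u - 1 / 2)) • 1 := by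
  rw [opA, opA1, opA0]
  module

theorem opDD_eq (δ u : ℂ) : opDD δ u = (u + 1) • opXinv - opD + (δ / (u - 1 / 2)) • 1 := by
  rw [opDD, opA1, opA0]
  module

theorem opC_eq (δ u : ℂ) : opC δ u = opC δ 0 + (u ^ 2) • 1 := by
  rw [opC, opC]; simp

/-- For $\delta=0$ and $u=\frac12$ the convention $0/0=0$ makes the quotient vanish, as the absent
term should. -/
theorem div_mul_of_mem_spectralSet {δ u : ℂ} (hu : u ∈ spectralSet δ) :
    δ / (u - 1 / 2) * (u - 1 / 2) = δ := by
  rcases hu with h | h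
  · simp [h]
  · exact div_mul_cancel₀ _ (sub_ne_zero.2 h)

end

noncomputable section

theorem reflection_opU {δ u v : ℂ} (hu : u ∈ spectralSet δ) (hv : v ∈ spectralSet δ) :
    reflectionLeft u v (opU δ u) (opU δ v) = reflectionRight u v (opU δ u) (opU δ v) := by
  refine (isShiftTriple_op δ).reflection (div_mul_of_mem_spectralSet hu)
    (div_mul_of_mem_spectralSet hv) _ _ ?_ ?_
  · rw [opU, opA_eq, opDD_eq, opC_eq]; rfl
  · rw [opU, opA_eq, opDD_eq, opC_eq]; rfl

/-- The entries of `U(u)` satisfy the symmetry relations under `u ↦ -u`. -/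
theorem symm_op {δ u : ℂ} (hu : u ∈ spectralSet δ) (hv : -u ∈ spectralSet δ)
    (h : 2 * u + 1 ≠ 0) :
    opA δ (-u) + opDD δ u = (2 * u + 1)⁻¹ • (opA δ u + opDD δ u) ∧
    opDD δ (-u) + opA δ u = (2 * u + 1)⁻¹ • (opA δ u + opDD δ u) := by
  have hu' := div_mul_of_mem_spectralSet hu
  have hv' := div_mul_of_mem_spectralSet hv
  have hc : (2 * u + 1)⁻¹ * (2 * u + 1) = 1 := inv_mul_cancel₀ h
  simp only [opA_eq, opDD_eq]
  generalize δ / (u - 1 / 2) = κ at hu'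
  generalize δ / (-u - 1 / 2) = η at hv'
  generalize (2 * u + 1)⁻¹ = c at hc
  -- Both $\kappa(u-\frac12)$ and $\eta(-u-\frac12)$ equal $\delta$, so $\eta$ can be eliminated
  -- once $2u+1$ is invertible.
  have hη : η = -κ * (2 * u - 1) * c := by
    linear_combination (-2 * c) * hv' + (2 * c) * hu' - η * hc
  subst hη
  constructor <;> match_scalars <;> grind

/-- Universal properties of the free algebra and of the quotient. The matrix $R$ has scalar entries,
so an algebra homomorphism applied entrywise carries the reflection equation over. -/
theorem isQISMRep_of_relations {S : Set ℂ} {W : Type*} [AddCommGroup W] [Module ℂ W]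
    {U : ℂ → Matrix (Fin 2) (Fin 2) (Module.End ℂ W)}
    (hrefl : ∀ u ∈ S, ∀ v ∈ S, reflectionLeft u v (U u) (U v) = reflectionRight u v (U u) (U v))
    (hsA : ∀ u ∈ S, -u ∈ S → 2 * u + 1 ≠ 0 →
      U (-u) 0 0 + U u 1 1 = (2 * u + 1)⁻¹ • (U u 0 0 + U u 1 1))
    (hsD : ∀ u ∈ S, -u ∈ S → 2 * u + 1 ≠ 0 →
      U (-u) 1 1 + U u 0 0 = (2 * u + 1)⁻¹ • (U u 0 0 + U u 1 1))
    (hsB : ∀ u, U (-u) 0 1 = U u 0 1) (hsC : ∀ u, U (-u) 1 0 = U u 1 0) :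
    IsQISMRep S U := by
  let g : FreeQISM S →ₐ[ℂ] Module.End ℂ W :=
    FreeAlgebra.lift ℂ fun t => U t.1 t.2.1 t.2.2
  have hg (u : S) (i j : Fin 2) : g (freeU _ u i j) = U u i j := by
    simp [g, freeU]
  have hmap (u : S) : (freeU _ u).map g = U u := by
    ext i j : 1
    exact hg u i j
  have hR (z : ℂ) : (rMatrix (FreeQISM S) z).map g = rMatrix _ z := by
    ext p q : 1
    simp only [rMatrix, Matrix.map_apply, Matrix.add_apply, Matrix.smul_apply, Matrix.of_apply,
      Matrix.one_apply, map_add, map_smul]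
    split_ifs <;> simp
  have h1 (M : Matrix (Fin 2) (Fin 2) (FreeQISM S)) :
      (firstLeg M).map g = firstLeg (M.map g) := by
    ext p q : 1
    simp only [firstLeg, Matrix.map_apply, Matrix.kroneckerMap_apply, Matrix.one_apply, map_mul]
    split_ifs <;> simp
  have h2 (M : Matrix (Fin 2) (Fin 2) (FreeQISM S)) :
      (secondLeg M).map g = secondLeg (M.map g) := by
    ext p q : 1
    simp only [secondLeg, Matrix.map_apply, Matrix.kroneckerMap_apply, Matrix.one_apply, map_mul]
    split_ifs <;> simp
  have hrel : ∀ ⦃x y⦄, QISMRel S x y → g x = g y := by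
    intro x y hxy
    induction hxy with
    | reflection u v p q =>
      have hl : (reflectionLeft (u : ℂ) v (freeU _ u) (freeU _ v)).map g =
          (reflectionRight (u : ℂ) v (freeU _ u) (freeU _ v)).map g := by
        simp only [reflectionLeft, reflectionRight, Matrix.map_mul, hR, h1, h2, hmap]
        exact hrefl u u.2 v v.2
      exact congrFun (congrFun hl p) q
    | symmA u v hv hu =>
      rw [map_neg, map_sub, map_smul, map_add, hg, hg, hg, neg_eq_iff_add_eq_zero,
        add_sub, sub_eq_zero]
      have := v.2
      rw [hv] at this ⊢
      exact hsA u u.2 this hu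
    | symmD u v hv hu =>
      rw [map_neg, map_sub, map_smul, map_add, hg, hg, hg, neg_eq_iff_add_eq_zero,
        add_sub, sub_eq_zero]
      have := v.2
      rw [hv] at this ⊢
      exact hsD u u.2 this hu
    | symmB u v hv => rw [hg, hg, hv, hsB]
    | symmC u v hv => rw [hg, hg, hv, hsC]
  refine ⟨RingQuot.liftAlgHom ℂ ⟨g, hrel⟩, fun u i j => ?_⟩
  rw [qismGen, Matrix.map_apply, RingQuot.liftAlgHom_mkAlgHom_apply]
  exact hg u i j

theorem opU_apply (δ u : ℂ) : opU δ u 0 0 = opA δ u ∧ opU δ u 0 1 = opB ∧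
    opU δ u 1 0 = opC δ u ∧ opU δ u 1 1 = opDD δ u := by
  rw [opU]
  refine ⟨?_, ?_, ?_, ?_⟩ <;> simp

theorem opC_neg (δ u : ℂ) : opC δ (-u) = opC δ u := by
  rw [opC, opC, neg_sq]

theorem isQISMRep_opU (δ : ℂ) : IsQISMRep (spectralSet δ) (opU δ) := by
  refine isQISMRep_of_relations (fun u hu v hv => reflection_opU hu hv)
    (fun u hu hv h => ?_) (fun u hu hv h => ?_) (fun u => ?_) (fun u => ?_)
  · rw [(opU_apply δ (-u)).1, (opU_apply δ u).1, (opU_apply δ u).2.2.2]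
    exact (symm_op hu hv h).1
  · rw [(opU_apply δ (-u)).2.2.2, (opU_apply δ u).1, (opU_apply δ u).2.2.2]
    exact (symm_op hu hv h).2
  · rw [(opU_apply δ (-u)).2.1, (opU_apply δ u).2.1]
  · rw [(opU_apply δ (-u)).2.2.1, (opU_apply δ u).2.2.1, opC_neg]

/-! ## Factorization of `C(u)` -/

/-- The second-order operator $x^{-2}C(u)$ splits into first-order factors up to a constant;
$\kappa(2u-1)=2\delta$ is what matches the coefficient of $x^{-1}$. -/
theorem IsShiftTriple.factor {𝒜 : Type*} [Ring 𝒜] [Algebra ℂ 𝒜] {δ : ℂ} {Y D C : 𝒜}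
    (h : IsShiftTriple δ Y D C) {u κ : ℂ} (hu : κ * (u - 1 / 2) = δ) :
    ((u - 1) • Y - D + κ • 1) * (u • Y + D + κ • 1) =
      Y * (Y * (C + (u ^ 2) • 1)) + (κ ^ 2 - 1 / 4) • 1 := by
  simp only [add_mul, mul_add, sub_mul, smul_mul_assoc, mul_smul_comm, mul_one, one_mul,
    h.d_y, h.d_d]
  match_scalars <;> grind

theorem div_eq_of_opA_eq_zero {δ u : ℂ} (hu : u ∈ spectralSet δ) {w : rapidSpace} (hw : w ≠ 0)
    (hC : opC δ u w = 0) (hA : opA δ u w = 0) :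
    δ / (u - 1 / 2) = 1 / 2 ∨ δ / (u - 1 / 2) = -1 / 2 := by
  have hu' := div_mul_of_mem_spectralSet hu
  rw [opA_eq] at hA
  generalize δ / (u - 1 / 2) = κ at hu' hA
  have h := LinearMap.congr_fun ((isShiftTriple_op δ).factor hu') w
  have h2 : (0 : rapidSpace) = (κ ^ 2 - 1 / 4) • w := by
    rw [opC_eq] at hC
    have e : ((u - 1) • opXinv - opD + κ • 1 : Module.End ℂ rapidSpace)
        ((u • opXinv + opD + κ • 1 : Module.End ℂ rapidSpace) w) =
        opXinv (opXinv ((opC δ 0 + (u ^ 2) • 1 : Module.End ℂ rapidSpace) w)) + (κ ^ 2 - 1 / 4) • w := h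
    rwa [hA, hC, map_zero, map_zero, map_zero, zero_add] at e
  have h3 : κ ^ 2 - 1 / 4 = 0 := (smul_eq_zero.1 h2.symm).resolve_right hw
  have h4 : (κ - 1 / 2) * (κ + 1 / 2) = 0 := by linear_combination h3
  rcases mul_eq_zero.1 h4 with h | h
  · left; linear_combination h
  · right; linear_combination h

end

noncomputable section
open MeasureTheory Set Filter Asymptotics

/-! ## The null space of `C(u)` -/

theorem hasDerivAt_eval_inv (P : Polynomial ℂ) {x : ℝ} (hx : 0 < x) :
    HasDerivAt (fun x : ℝ => P.eval (x : ℂ)⁻¹)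
      (-((x : ℂ)⁻¹) ^ 2 * P.derivative.eval (x : ℂ)⁻¹) x := by
  have hx' : (x : ℂ) ≠ 0 := by exact_mod_cast hx.ne'
  have h0 : HasDerivAt (fun x : ℝ => (x : ℂ)⁻¹) (-1 / (x : ℂ) ^ 2) x :=
    (hasDerivAt_ofReal x).inv hx'
  refine ((P.hasDerivAt (x : ℂ)⁻¹).comp x h0).congr_deriv ?_
  field_simp

/-- A rapidly decreasing solution of a second order equation with coefficients polynomial in `x⁻¹`
belongs to `W` if its derivative is rapidly decreasing. -/
theorem isRapid_of_ode {w : ℝ → ℂ} (h0 : ∀ x ≤ 0, w x = 0) (ha : AnalyticOnNhd ℝ w (Ioi 0))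
    (A B : Polynomial ℂ) (hode : ∀ x : ℝ, 0 < x →
      deriv (deriv w) x = A.eval (x : ℂ)⁻¹ * w x + B.eval (x : ℂ)⁻¹ * deriv w x)
    (hw : ∀ N : ℕ, Tendsto (fun x : ℝ => (x : ℂ) ^ N * w x) atTop (𝓝 0))
    (hw' : ∀ N : ℕ, Tendsto (fun x : ℝ => (x : ℂ) ^ N * deriv w x) atTop (𝓝 0)) :
    IsRapid w where
  zero := h0
  analytic := ha
  decay p N := by
    -- The span of $w,w'$ over $\mathbb C[x^{-1}]$ is closed under differentiation, and polynomials
    -- in $x^{-1}$ have limits at infinity, so decay of $w$ and $w'$ suffices.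
    have key : ∃ P Q : Polynomial ℂ, ∀ x : ℝ, 0 < x → iteratedDeriv p w x =
        P.eval (x : ℂ)⁻¹ * w x + Q.eval (x : ℂ)⁻¹ * deriv w x := by
      induction p with
      | zero => exact ⟨1, 0, fun x _ => by simp⟩
      | succ p ih =>
        obtain ⟨P, Q, h⟩ := ih
        refine ⟨-(Polynomial.X ^ 2 * P.derivative) + Q * A,
          -(Polynomial.X ^ 2 * Q.derivative) + P + Q * B, fun x hx => ?_⟩
        have hev : iteratedDeriv p w =ᶠ[𝓝 x] fun x : ℝ =>
            P.eval (x : ℂ)⁻¹ * w x + Q.eval (x : ℂ)⁻¹ * deriv w x := by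
          filter_upwards [lt_mem_nhds hx] with y hy using h y hy
        have d := ((hasDerivAt_eval_inv P hx).mul (ha x hx).differentiableAt.hasDerivAt).add
          ((hasDerivAt_eval_inv Q hx).mul (ha.deriv x hx).differentiableAt.hasDerivAt)
        rw [iteratedDeriv_succ, hev.deriv_eq]
        refine d.deriv.trans ?_
        rw [hode x hx]
        simp only [Polynomial.eval_add, Polynomial.eval_neg, Polynomial.eval_mul,
          Polynomial.eval_pow, Polynomial.eval_X]
        ring
    obtain ⟨P, Q, h⟩ := key
    have hinv : Tendsto (fun x : ℝ => (x : ℂ)⁻¹) atTop (𝓝 0) := by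
      have := (Complex.continuous_ofReal.tendsto (0 : ℝ)).comp tendsto_inv_atTop_zero
      simpa [Function.comp_def] using this
    have hP (P : Polynomial ℂ) : Tendsto (fun x : ℝ => P.eval (x : ℂ)⁻¹) atTop (𝓝 (P.eval 0)) :=
      (P.continuous.tendsto 0).comp hinv
    have hlim := ((hP P).mul (hw N)).add ((hP Q).mul (hw' N))
    rw [mul_zero, mul_zero, add_zero] at hlim
    refine hlim.congr' ?_
    filter_upwards [eventually_gt_atTop 0] with x hx
    rw [h x hx]
    ring

theorem opC_apply (δ u : ℂ) (f : rapidSpace) (x : ℝ) : (opC δ u f).1 x =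
    -(x * (x * deriv (deriv f.1) x)) - x * deriv f.1 x + 1 / 4 * (x * (x * f.1 x)) +
      2 * δ * (x * f.1 x) + u ^ 2 * f.1 x := rfl

theorem opA_apply (δ u : ℂ) (f : rapidSpace) (x : ℝ) : (opA δ u f).1 x =
    u * ((x : ℂ)⁻¹ * f.1 x) + deriv f.1 x + δ / (u - 1 / 2) * f.1 x := by
  rw [opA_eq]
  rfl

theorem exists_ne_zero_of_ne_zero {g : rapidSpace} (hg : g ≠ 0) : ∃ x : ℝ, 0 < x ∧ g.1 x ≠ 0 := by
  by_contra! h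
  exact hg (rapidSpace_ext fun x hx => h x hx)

/-- The null space of `C(u)` is at most one-dimensional. -/
theorem exists_eq_smul_of_opC_eq_zero {δ u : ℂ} {f g : rapidSpace} (hf : opC δ u f = 0)
    (hg : opC δ u g = 0) (hg0 : g ≠ 0) : ∃ k : ℂ, f = k • g := by
  obtain ⟨x₀, hx₀, h0⟩ := exists_ne_zero_of_ne_zero hg0
  have hode (f : rapidSpace) (hf : opC δ u f = 0) (x : ℝ) :
      -((x : ℂ) * (x * deriv (deriv f.1) x)) - x * deriv f.1 x + 1 / 4 * (x * (x * f.1 x)) +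
      2 * δ * (x * f.1 x) + u ^ 2 * f.1 x = 0 := by
    rw [← opC_apply, hf]; rfl
  have hfa := IsRapid.analytic f.2
  have hga := IsRapid.analytic g.2
  -- The first two terms of $C(u)$ are $-x\partial_x(x\partial_x)$, so $x$ is the integrating factor
  -- for this Wronskian.
  have dk : ∀ x : ℝ, 0 < x → HasDerivAt
      (fun x : ℝ => (x : ℂ) * (deriv f.1 x * g.1 x - f.1 x * deriv g.1 x)) 0 x := by
    intro x hx
    refine ((hasDerivAt_ofReal x).mul
      (((hfa.deriv x hx).differentiableAt.hasDerivAt.mul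
        (hga x hx).differentiableAt.hasDerivAt).sub ((hfa x hx).differentiableAt.hasDerivAt.mul
        (hga.deriv x hx).differentiableAt.hasDerivAt))).congr_deriv ?_
    have hx' : (x : ℂ) ≠ 0 := by exact_mod_cast hx.ne'
    refine mul_left_cancel₀ hx' ?_
    simp only [Pi.mul_apply, Pi.sub_apply]
    linear_combination f.1 x * hode g hg x - g.1 x * hode f hf x
  have hconst : ∀ x : ℝ, 0 < x → ∀ y : ℝ, 0 < y →
      (y : ℂ) * (deriv f.1 y * g.1 y - f.1 y * deriv g.1 y) =
      (x : ℂ) * (deriv f.1 x * g.1 x - f.1 x * deriv g.1 x) := fun x hx y hy =>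
    isOpen_Ioi.is_const_of_deriv_eq_zero (𝕜 := ℝ)
      (f := fun x : ℝ => (x : ℂ) * (deriv f.1 x * g.1 x - f.1 x * deriv g.1 x)) isPreconnected_Ioi
      (fun z hz => (dk z hz).differentiableAt.differentiableWithinAt)
      (fun z hz => (dk z hz).deriv) hy hx
  have hlim : Tendsto (fun x : ℝ => (x : ℂ) * (deriv f.1 x * g.1 x - f.1 x * deriv g.1 x))
      atTop (𝓝 0) := by
    have h := ((IsRapid.decay f.2 1 1).mul (IsRapid.decay g.2 0 0)).sub
      ((IsRapid.decay f.2 0 0).mul (IsRapid.decay g.2 1 1))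
    rw [mul_zero, sub_zero] at h
    refine h.congr fun x => ?_
    rw [iteratedDeriv_one, iteratedDeriv_one, iteratedDeriv_zero, iteratedDeriv_zero]
    ring
  obtain ⟨k, hk⟩ := exists_eq_mul_of_wronskian hfa hga hx₀ h0 (fun x hx => by
    have h1 : (x : ℂ) * (deriv f.1 x * g.1 x - f.1 x * deriv g.1 x) = 0 := by
      refine tendsto_nhds_unique (tendsto_const_nhds.congr' ?_) hlim
      filter_upwards [eventually_gt_atTop 0] with y hy using (hconst x hx y hy).symm
    have hx' : (x : ℂ) ≠ 0 := by exact_mod_cast hx.ne'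
    exact sub_eq_zero.1 ((mul_eq_zero.1 h1).resolve_left hx'))
  exact ⟨k, rapidSpace_ext hk⟩

/-! ### From the confluent equation to the null vector $F(u)$ -/

/-- `x ^ u * exp (-x / 2) * f x` on `(0, ∞)`, extended by zero. -/
def whittaker (u : ℂ) (f : ℝ → ℂ) (x : ℝ) : ℂ :=
  if 0 < x then (x : ℂ) ^ u * Complex.exp (-(1 / 2 * x : ℝ)) * f x else 0

theorem analyticAt_cpow_mul_exp (u : ℂ) {x : ℝ} (hx : 0 < x) :
    AnalyticAt ℝ (fun x : ℝ => (x : ℂ) ^ u * Complex.exp (-(1 / 2 * x : ℝ))) x := by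
  have hid : AnalyticAt ℝ (fun x : ℝ => (x : ℂ)) x := Complex.ofRealCLM.analyticAt x
  have h1 : AnalyticAt ℂ (fun z : ℂ => z ^ u * Complex.exp (-(1 / 2 * z))) (x : ℂ) :=
    (analyticAt_id.cpow analyticAt_const (Or.inl (by simpa using hx))).mul (by fun_prop)
  have h2 := (h1.restrictScalars (𝕜 := ℝ)).comp hid
  refine h2.congr (Eventually.of_forall fun y => ?_)
  simp

theorem whittaker_eventuallyEq (u : ℂ) (f : ℝ → ℂ) {x : ℝ} (hx : 0 < x) : whittaker u f =ᶠ[𝓝 x]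
    fun x : ℝ => (x : ℂ) ^ u * Complex.exp (-(1 / 2 * x : ℝ)) * f x := by
  filter_upwards [lt_mem_nhds hx] with y hy
  rw [whittaker, if_pos hy]

theorem hasDerivAt_whittaker (u : ℂ) {f : ℝ → ℂ} {f' : ℂ} {x : ℝ} (hx : 0 < x)
    (hf : HasDerivAt f f' x) : HasDerivAt (whittaker u f)
      ((x : ℂ) ^ u * Complex.exp (-(1 / 2 * x : ℝ)) * f' +
        (u * (x : ℂ)⁻¹ - 1 / 2) * whittaker u f x) x := by
  refine HasDerivAt.congr_of_eventuallyEq ?_ (whittaker_eventuallyEq u f hx)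
  refine (((hasDerivAt_ofReal_cpow u hx).mul (hasDerivAt_exp_neg_mul (1 / 2) x)).mul
    hf).congr_deriv ?_
  have hx' : (x : ℂ) ≠ 0 := by exact_mod_cast hx.ne'
  rw [whittaker, if_pos hx, Complex.cpow_sub _ _ hx', Complex.cpow_one]
  simp only [Pi.mul_apply]
  push_cast
  ring

section
variable {δ u : ℂ} {f : ℝ → ℂ}

theorem IsTricomiPsiStrong.deriv_whittaker {a c : ℂ} (hf : IsTricomiPsiStrong a c f) (u : ℂ)
    {x : ℝ} (hx : 0 < x) : deriv (whittaker u f) x = whittaker u (deriv f) x +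
        (u * (x : ℂ)⁻¹ - 1 / 2) * whittaker u f x := by
  rw [(hasDerivAt_whittaker u hx (hf.analytic x hx).differentiableAt.hasDerivAt).deriv]
  congr 1
  rw [whittaker, if_pos hx]

/-- The prefactor $x^ue^{-x/2}$ converts the confluent equation with $a=2\delta+\frac12+u$, $c=2u+1$
into $C(u)w=0$, here solved for $w''$ in the shape `isRapid_of_ode` needs. -/
theorem IsTricomiPsiStrong.deriv_deriv_whittaker
    (hf : IsTricomiPsiStrong (2 * δ + 1 / 2 + u) (2 * u + 1) f) {x : ℝ} (hx : 0 < x) :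
    deriv (deriv (whittaker u f)) x = (1 / 4 + 2 * δ * (x : ℂ)⁻¹ + u ^ 2 * ((x : ℂ)⁻¹) ^ 2) *
      whittaker u f x - (x : ℂ)⁻¹ * deriv (whittaker u f) x := by
  have hx' : (x : ℂ) ≠ 0 := by exact_mod_cast hx.ne'
  have hev : deriv (whittaker u f) =ᶠ[𝓝 x] fun x : ℝ => whittaker u (deriv f) x +
      (u * (x : ℂ)⁻¹ - 1 / 2) * whittaker u f x := by
    filter_upwards [lt_mem_nhds hx] with y hy using hf.deriv_whittaker u hy
  have h0 : HasDerivAt (fun x : ℝ => (x : ℂ)⁻¹) (-1 / (x : ℂ) ^ 2) x :=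
    (hasDerivAt_ofReal x).inv hx'
  have d := (hasDerivAt_whittaker u hx (hf.analytic.deriv x hx).differentiableAt.hasDerivAt).add
    (((h0.const_mul u).sub_const (1 / 2)).mul
      (hasDerivAt_whittaker u hx (hf.analytic x hx).differentiableAt.hasDerivAt))
  rw [hev.deriv_eq]
  refine d.deriv.trans ?_
  rw [hf.deriv_whittaker u hx]
  simp only [whittaker, if_pos hx]
  have ho := hf.ode x hx
  have ho' : deriv (deriv f) x = (x : ℂ)⁻¹ * ((2 * δ + 1 / 2 + u) * f x -
      (2 * u + 1 - x) * deriv f x) := by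
    field_simp
    linear_combination 2 * ho
  rw [ho']
  field_simp
  ring

theorem isRapid_whittaker (hf : IsTricomiPsiStrong (2 * δ + 1 / 2 + u) (2 * u + 1) f) :
    IsRapid (whittaker u f) := by
  have hdec : ∀ g : ℝ → ℂ, ∀ M : ℕ, g =O[atTop] (fun x : ℝ => x ^ M) → ∀ N : ℕ,
      Tendsto (fun x : ℝ => (x : ℂ) ^ N * whittaker u g x) atTop (𝓝 0) := by
    intro g M hg N
    refine (tendsto_pow_mul_cpow_mul_exp M (u + N) (b := 1 / 2) (by norm_num) hg).congr' ?_
    filter_upwards [eventually_gt_atTop 0] with x hx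
    have hx' : (x : ℂ) ≠ 0 := by exact_mod_cast hx.ne'
    rw [whittaker, if_pos hx, Complex.cpow_add _ _ hx', Complex.cpow_natCast]
    ring
  obtain ⟨M, hM⟩ := exists_isBigO_pow (-(2 * δ + 1 / 2 + u))
  obtain ⟨M', hM'⟩ := exists_isBigO_pow (-(2 * δ + 1 / 2 + u) - 1)
  have t0 := hdec f M (hf.isBigO.trans hM)
  have t1 := hdec (deriv f) M' (hf.deriv_isBigO.trans hM')
  refine isRapid_of_ode (fun x hx => if_neg (not_lt.2 hx)) (fun x hx => ?_)
    (Polynomial.C (1 / 4) + Polynomial.C (2 * δ) * Polynomial.X +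
      Polynomial.C (u ^ 2) * Polynomial.X ^ 2) (-Polynomial.X) (fun x hx => ?_) t0 (fun N => ?_)
  · exact ((analyticAt_cpow_mul_exp u hx).mul (hf.analytic x hx)).congr
      (whittaker_eventuallyEq u f hx).symm
  · rw [hf.deriv_deriv_whittaker hx]
    simp only [Polynomial.eval_add, Polynomial.eval_mul, Polynomial.eval_C, Polynomial.eval_X,
      Polynomial.eval_pow, Polynomial.eval_neg]
    ring
  · have hinv : Tendsto (fun x : ℝ => (x : ℂ)⁻¹) atTop (𝓝 0) := by
      have := (Complex.continuous_ofReal.tendsto (0 : ℝ)).comp tendsto_inv_atTop_zero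
      simpa [Function.comp_def] using this
    have hl := (t1 N).add (((hinv.const_mul u).sub_const (1 / 2)).mul (t0 N))
    rw [mul_zero, add_zero] at hl
    refine hl.congr' ?_
    filter_upwards [eventually_gt_atTop 0] with x hx
    rw [hf.deriv_whittaker u hx]
    ring

theorem whittaker_congr {g : ℝ → ℂ} (h : ∀ x : ℝ, 0 < x → f x = g x) :
    whittaker u f = whittaker u g := by
  funext x
  by_cases hx : 0 < x
  · rw [whittaker, whittaker, if_pos hx, if_pos hx, h x hx]
  · rw [whittaker, whittaker, if_neg hx, if_neg hx]

end

theorem isRapid_tricomi (δ u : ℂ) :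
    IsRapid (whittaker u (tricomiPsi (2 * δ + 1 / 2 + u) (2 * u + 1))) := by
  obtain ⟨f, hf, h⟩ := exists_strong_eq_tricomiPsi (2 * δ + 1 / 2 + u) (2 * u + 1)
  rw [whittaker_congr h]
  exact isRapid_whittaker hf

/-- The element `F(u)` of `W`. -/
def tricomiF (δ u : ℂ) : rapidSpace :=
  ⟨whittaker u (tricomiPsi (2 * δ + 1 / 2 + u) (2 * u + 1)), isRapid_tricomi δ u⟩

theorem exp_half (x : ℝ) :
    Complex.exp (-(1 / 2 * x : ℝ)) = Complex.exp (-(x : ℂ) / 2) := by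
  congr 1
  push_cast
  ring

theorem tricomiF_apply (δ u : ℂ) {x : ℝ} (hx : 0 < x) : (tricomiF δ u).1 x =
    (x : ℂ) ^ u * Complex.exp (-(x : ℂ) / 2) * tricomiPsi (2 * δ + 1 / 2 + u) (2 * u + 1) x := by
  rw [← exp_half]
  exact if_pos hx

theorem opC_tricomiF (δ u : ℂ) : opC δ u (tricomiF δ u) = 0 := by
  obtain ⟨f, hf, h⟩ := exists_strong_eq_tricomiPsi (2 * δ + 1 / 2 + u) (2 * u + 1)
  refine rapidSpace_ext fun x hx => ?_
  have hx' : (x : ℂ) ≠ 0 := by exact_mod_cast hx.ne'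
  have e : (tricomiF δ u).1 = whittaker u f := whittaker_congr h
  rw [opC_apply, e, hf.deriv_deriv_whittaker hx]
  change _ = (0 : ℂ)
  field_simp
  ring

theorem tricomiF_ne_zero (δ u : ℂ) : tricomiF δ u ≠ 0 := by
  obtain ⟨f, hf, h⟩ := exists_strong_eq_tricomiPsi (2 * δ + 1 / 2 + u) (2 * u + 1)
  obtain ⟨x, hx, hne⟩ := hf.isTricomiPsi.exists_ne_zero
  intro h0
  have h1 : (tricomiF δ u).1 x = 0 := by rw [h0]; rfl
  rw [tricomiF_apply δ u hx, h x hx] at h1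
  have hx' : (x : ℂ) ≠ 0 := by exact_mod_cast hx.ne'
  simp [Complex.cpow_eq_zero_iff, hx', hne] at h1

theorem finrank_ker_eq_one {W : Type*} [AddCommGroup W] [Module ℂ W] {T : Module.End ℂ W} {v : W}
    (hv : v ≠ 0) (hT : T v = 0) (h : ∀ w, T w = 0 → ∃ k : ℂ, w = k • v) :
    Module.finrank ℂ (LinearMap.ker T) = 1 := by
  refine finrank_eq_one_iff'.2 ⟨⟨v, LinearMap.mem_ker.2 hT⟩, fun e => ?_, fun w => ?_⟩
  · exact hv (congrArg Subtype.val e)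
  · obtain ⟨k, hk⟩ := h w w.2
    exact ⟨k, Subtype.ext hk.symm⟩

theorem finrank_ker_opC (δ u : ℂ) : Module.finrank ℂ (LinearMap.ker (opC δ u)) = 1 :=
  finrank_ker_eq_one (tricomiF_ne_zero δ u) (opC_tricomiF δ u) fun _ hw =>
    exists_eq_smul_of_opC_eq_zero hw (opC_tricomiF δ u) (tricomiF_ne_zero δ u)

end

noncomputable section
open MeasureTheory Set Filter Asymptotics Polynomial

/-! ## Laguerre polynomials -/

theorem laguerrePoly_coeff (n : ℕ) (α : ℂ) (k : ℕ) : (laguerrePoly n α).coeff k =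
    if k ≤ n then (-1) ^ k * (ascPochhammer ℂ (n - k)).eval (α + k + 1) /
      ((n - k).factorial * k.factorial : ℂ) else 0 := by
  rw [laguerrePoly, finsetSum_coeff]
  simp only [coeff_monomial]
  rw [Finset.sum_ite_eq']
  simp

theorem laguerrePoly_natDegree (n : ℕ) (α : ℂ) : (laguerrePoly n α).natDegree = n := by
  refine natDegree_eq_of_le_of_coeff_ne_zero ?_ ?_
  · rw [natDegree_le_iff_coeff_eq_zero]
    intro k hk
    rw [laguerrePoly_coeff, if_neg (by omega)]
  · rw [laguerrePoly_coeff, if_pos le_rfl]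
    simp [Nat.factorial_ne_zero]

/-- Peeling the first factor off the rising factorial gives this without dividing by $\alpha+k+1$,
so it holds even at negative integers $\alpha$. -/
theorem laguerrePoly_recurrence (n : ℕ) (α : ℂ) {k : ℕ} (hk : k < n) :
    (k + 1 : ℂ) * (k + α + 1) * (laguerrePoly n α).coeff (k + 1) =
      (k - n : ℂ) * (laguerrePoly n α).coeff k := by
  rw [laguerrePoly_coeff, laguerrePoly_coeff, if_pos hk.le, if_pos (Nat.succ_le_of_lt hk)]
  obtain ⟨m, rfl⟩ : ∃ m, n = k + 1 + m := ⟨n - (k + 1), by omega⟩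
  have h1 : k + 1 + m - (k + 1) = m := by omega
  have h2 : k + 1 + m - k = m + 1 := by omega
  rw [h1, h2, ascPochhammer_succ_left, Nat.factorial_succ, Nat.factorial_succ]
  simp only [eval_mul, eval_X, eval_comp, eval_add, eval_one]
  have hm : (m.factorial : ℂ) ≠ 0 := by exact_mod_cast m.factorial_ne_zero
  have hk' : (k.factorial : ℂ) ≠ 0 := by exact_mod_cast k.factorial_ne_zero
  have hk1 : (k + 1 : ℂ) ≠ 0 := by exact_mod_cast k.succ_ne_zero
  have hm1 : (m + 1 : ℂ) ≠ 0 := by exact_mod_cast m.succ_ne_zero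
  push_cast
  rw [show α + (k + 1) + 1 = α + k + 1 + 1 by ring]
  field_simp
  ring

theorem laguerrePoly_ode (n : ℕ) (α : ℂ) :
    X * derivative (derivative (laguerrePoly n α)) +
      (C (α + 1) - X) * derivative (laguerrePoly n α) + C (n : ℂ) * laguerrePoly n α = 0 := by
  ext k
  have hrec : (k + 1 : ℂ) * (k + α + 1) * (laguerrePoly n α).coeff (k + 1) =
      (k - n : ℂ) * (laguerrePoly n α).coeff k := by
    rcases lt_trichotomy k n with h | h | h
    · exact laguerrePoly_recurrence n α h
    · rw [laguerrePoly_coeff n α (k + 1), if_neg (by omega), h]; ring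
    · rw [laguerrePoly_coeff n α (k + 1), if_neg (by omega), laguerrePoly_coeff n α k,
        if_neg (by omega)]; ring
  rcases k with _ | k
  · simp only [sub_mul, coeff_add, coeff_sub, coeff_C_mul, coeff_X_mul_zero, coeff_derivative,
      coeff_zero]
    push_cast at hrec ⊢
    linear_combination hrec
  · simp only [sub_mul, coeff_add, coeff_sub, coeff_C_mul, coeff_X_mul, coeff_derivative,
      coeff_zero]
    push_cast at hrec ⊢
    linear_combination hrec

/-- The factor $(-1)^nn!$ makes the polynomial monic, which is the normalization $x^{-a}$ for
$a=-n$; the remaining terms have degree below $n$. -/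
theorem isTricomiPsi_laguerre (n : ℕ) (α : ℂ) : IsTricomiPsi (-n) (α + 1)
    (fun x : ℝ => (-1) ^ n * (n.factorial : ℂ) * (laguerrePoly n α).eval (x : ℂ)) := by
  set P : ℂ[X] := C ((-1) ^ n * (n.factorial : ℂ)) * laguerrePoly n α with hP
  have e : (fun x : ℝ => (-1) ^ n * (n.factorial : ℂ) * (laguerrePoly n α).eval (x : ℂ)) =
      fun x : ℝ => P.eval (x : ℂ) := by
    funext x
    rw [hP, eval_mul, eval_C]
  have hd (P : ℂ[X]) : deriv (fun x : ℝ => P.eval (x : ℂ)) =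
      fun x : ℝ => P.derivative.eval (x : ℂ) := by
    funext x
    exact (P.hasDerivAt (x : ℂ)).comp_ofReal.deriv
  have hO (P : ℂ[X]) (m : ℕ) (hm : P.natDegree ≤ m) :
      (fun x : ℝ => P.eval (x : ℂ)) =O[atTop] fun x : ℝ => x ^ m := by
    simp only [eval_eq_sum_range]
    refine IsBigO.fun_sum fun i hi => IsBigO.const_mul_left ?_ _
    refine IsBigO.of_bound 1 ?_
    filter_upwards [eventually_ge_atTop 1] with x hx
    have hx0 : 0 ≤ x := by linarith
    rw [norm_pow, norm_pow, Complex.norm_real, Real.norm_of_nonneg hx0, one_mul]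
    exact pow_le_pow_right₀ hx ((Nat.lt_succ_iff.1 (Finset.mem_range.1 hi)).trans hm)
  have hdeg : P.natDegree ≤ n := (natDegree_C_mul_le _ _).trans (laguerrePoly_natDegree n α).le
  rw [e]
  refine ⟨fun x _ => ?_, fun x hx => ?_, ⟨n, hO P n hdeg⟩, ?_⟩
  · have h1 : AnalyticAt ℂ (fun z : ℂ => P.eval z) (x : ℂ) :=
      (AnalyticAt.aeval_polynomial analyticAt_id P)
    exact (h1.restrictScalars (𝕜 := ℝ)).comp (Complex.ofRealCLM.analyticAt x)
  · rw [iteratedDeriv_succ, iteratedDeriv_one, hd, hd]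
    have h := congrArg (eval (x : ℂ)) (laguerrePoly_ode n α)
    simp only [eval_add, eval_mul, eval_X, eval_sub, eval_C, eval_zero] at h
    simp only [hP, derivative_C_mul, eval_mul, eval_C]
    linear_combination ((-1) ^ n * (n.factorial : ℂ)) * h
  · have hlead : P.coeff n = 1 := by
      rw [hP, coeff_C_mul, laguerrePoly_coeff, if_pos le_rfl]
      have hn : (n.factorial : ℂ) ≠ 0 := by exact_mod_cast n.factorial_ne_zero
      simp only [Nat.sub_self, ascPochhammer_zero, eval_one, Nat.factorial_zero, Nat.cast_one]
      field_simp
      rw [← pow_mul, mul_comm, pow_mul, neg_one_sq, one_pow]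
    rw [neg_neg]
    -- For $n=0$ the error bound is $x^{-1}$, out of reach of a degree estimate, but the polynomial
    -- is then exactly $1$.
    rcases n with _ | n
    · have h0 : P = 1 := by
        rw [eq_C_of_natDegree_le_zero hdeg, hlead, C_1]
      simp [h0]
      exact isBigO_zero _ _
    · have h1 : (fun x : ℝ => P.eval (x : ℂ) - (x : ℂ) ^ ((n + 1 : ℕ) : ℂ)) =
          fun x : ℝ => (P - X ^ (n + 1)).eval (x : ℂ) := by
        funext x
        rw [Complex.cpow_natCast, eval_sub, eval_pow, eval_X]
      rw [h1]
      have h2 : (P - X ^ (n + 1)).natDegree ≤ n := by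
        rw [natDegree_le_iff_coeff_eq_zero]
        intro k hk
        rw [coeff_sub, coeff_X_pow]
        rcases (Nat.succ_le_of_lt hk).eq_or_lt with h | h
        · rw [← h, if_pos rfl]
          exact sub_eq_zero.2 hlead
        · rw [if_neg (by omega), sub_zero]
          exact coeff_eq_zero_of_natDegree_lt (by omega)
      refine (hO _ n h2).trans (IsBigO.of_bound 1 (Eventually.of_forall fun x => ?_))
      rw [Nat.cast_succ, add_sub_cancel_right, Complex.cpow_natCast]
      simp

theorem isLaguerreForm_tricomiF {δ u : ℂ} {n : ℕ} (hu : u = -2 * δ - 1 / 2 - n) :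
    IsLaguerreForm δ u (tricomiF δ u) := by
  refine ⟨n, hu, fun x hx => ?_⟩
  have hx' : (x : ℂ) ≠ 0 := by exact_mod_cast hx.ne'
  obtain ⟨f, hf, h⟩ := exists_strong_eq_tricomiPsi (2 * δ + 1 / 2 + u) (2 * u + 1)
  have hL := isTricomiPsi_laguerre n (2 * u)
  have ha : (2 * δ + 1 / 2 + u) = -n := by rw [hu]; ring
  have h1 := hL.eq_strong (ha ▸ hf) hx
  have h2 : (tricomiF δ u).1 x = (-1) ^ n * (n.factorial : ℂ) * (x : ℂ) ^ u *
      Complex.exp (-(x : ℂ) / 2) * (laguerrePoly n (2 * u)).eval (x : ℂ) := by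
    rw [tricomiF_apply δ u hx, h x hx, ← h1]
    ring
  refine ⟨h2, ?_⟩
  rw [h2]
  let _ : Invertible (x : ℂ) := invertibleOfNonzero hx'
  -- Reversal is taken at the true degree, which is $n$ for every $\alpha$; the resulting $x^n$
  -- merges with $x^u$ because $u+n=-2\delta-\frac12$.
  have h3 := eval₂_reverse_mul_pow (RingHom.id ℂ) (x : ℂ) (laguerrePoly n (2 * u))
  rw [laguerrePoly_natDegree, invOf_eq_inv] at h3
  simp only [← eval₂_id]
  have h4 : (x : ℂ) ^ (-2 * δ - 1 / 2) = (x : ℂ) ^ u * (x : ℂ) ^ n := by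
    rw [← Complex.cpow_natCast, ← Complex.cpow_add _ _ hx', hu, sub_add_cancel]
  rw [← h3, h4]
  ring

end

noncomputable section

/-! ## The ends of the ladders -/

theorem meetsShiftHypotheses_tricomiF {δ u₀ : ℂ} {jm : WithBot ℤ} {jp : WithTop ℤ}
    (hS : ∀ u ∈ ladder u₀ jm jp, u ∈ spectralSet δ ∧ -u ∈ spectralSet δ)
    (hl : ∀ u ∈ ladder u₀ jm jp, ∀ w : rapidSpace, w ≠ 0 → opC δ u w = 0 →
      (opA δ u w = 0 ↔ ∃ j : ℤ, jm = (j : WithBot ℤ) ∧ u = u₀ + j + 1))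
    (hr : ∀ u ∈ ladder u₀ jm jp, ∀ w : rapidSpace, w ≠ 0 → opC δ u w = 0 →
      (opA δ (-u) w = 0 ↔ ∃ j : ℤ, jp = (j : WithTop ℤ) ∧ u = u₀ + j - 1)) :
    MeetsShiftHypotheses (spectralSet δ) (opU δ) u₀ jm jp (tricomiF δ) where
  isRep := isQISMRep_opU δ
  mem_domain := hS
  one_dim u _ := by rw [(opU_apply δ u).2.2.1]; exact finrank_ker_opC δ u
  lowering u hu w hw hC := by
    rw [(opU_apply δ u).2.2.1] at hC
    rw [(opU_apply δ u).1]
    exact hl u hu w hw hC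
  raising u hu w hw hC := by
    rw [(opU_apply δ u).2.2.1] at hC
    rw [(opU_apply δ (-u)).1]
    rw [← hr u hu w hw hC]
    exact neg_eq_zero
  ne_zero u _ := tricomiF_ne_zero δ u
  annihilated u _ := by rw [(opU_apply δ u).2.2.1]; exact opC_tricomiF δ u

theorem opA_ne_zero {δ u : ℂ} (hu : u ∈ spectralSet δ) (h1 : u ≠ 1 / 2 + 2 * δ)
    (h2 : u ≠ 1 / 2 - 2 * δ) {w : rapidSpace} (hw : w ≠ 0) (hC : opC δ u w = 0) :
    opA δ u w ≠ 0 := by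
  intro hA
  have hu' := div_mul_of_mem_spectralSet hu
  rcases div_eq_of_opA_eq_zero hu hw hC hA with h | h <;> rw [h] at hu'
  · exact h1 (by linear_combination 2 * hu')
  · exact h2 (by linear_combination -2 * hu')

/-- `-A(-u)` annihilates `F(u)` for `u = -2δ - 1/2`. -/
theorem opA_neg_eq_zero {δ u : ℂ} (hδ : δ ≠ 0) (hu : u = -2 * δ - 1 / 2) {w : rapidSpace}
    (hC : opC δ u w = 0) : opA δ (-u) w = 0 := by
  obtain ⟨k, rfl⟩ := exists_eq_smul_of_opC_eq_zero hC (opC_tricomiF δ u) (tricomiF_ne_zero δ u)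
  rw [map_smul]
  suffices h : opA δ (-u) (tricomiF δ u) = 0 by rw [h, smul_zero]
  obtain ⟨f, hf, h⟩ := exists_strong_eq_tricomiPsi (2 * δ + 1 / 2 + u) (2 * u + 1)
  -- At this $u$ the first Tricomi parameter is $0$, so $\Psi=1$ and $F(u)=x^ue^{-x/2}$.
  have hL := isTricomiPsi_laguerre 0 (2 * u)
  have ha : (2 * δ + 1 / 2 + u) = -(0 : ℕ) := by rw [hu]; push_cast; ring
  have e : (tricomiF δ u).1 = whittaker u (fun _ => 1) := by
    refine whittaker_congr fun x hx => ?_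
    have h1 := hL.eq_strong (ha ▸ hf) hx
    rw [h x hx, ← h1]
    simp [laguerrePoly]
  refine rapidSpace_ext fun x hx => ?_
  have d := (hasDerivAt_whittaker u hx (hasDerivAt_const x (1 : ℂ))).deriv
  rw [opA_apply, e, d]
  -- This cancels the $-\frac12$ from differentiating the exponential; $\delta\ne0$ excludes $0/0$.
  have hk : δ / (-u - 1 / 2) = 1 / 2 := by
    rw [hu]
    field_simp
    ring
  rw [hk]
  change _ = (0 : ℂ)
  ring

theorem exists_nat_of_mem_ladder_top {u₀ u : ℂ} {jm : WithBot ℤ} {N : ℤ}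
    (hu : u ∈ ladder u₀ jm (N : WithTop ℤ)) : ∃ n : ℕ, u = u₀ + (N - 1) - n := by
  obtain ⟨m, -, h2, rfl⟩ := hu
  have h2 : m < N := WithTop.coe_lt_coe.1 h2
  refine ⟨(N - 1 - m).toNat, ?_⟩
  have : (((N - 1 - m).toNat : ℤ) : ℂ) = ((N - 1 - m : ℤ) : ℂ) := by
    rw [Int.toNat_of_nonneg (by omega)]
  push_cast at this
  rw [this]
  ring

/-! ### The three kinds of ladder -/

theorem meetsShiftHypotheses_infinite {δ u₀ : ℂ}
    (h : ∀ k : ℤ, u₀ ≠ (2 * δ + 1 / 2) + k ∧ u₀ ≠ -(2 * δ + 1 / 2) + k)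
    (h' : ∀ k : ℤ, u₀ ≠ 1 / 2 + k) :
    MeetsShiftHypotheses (spectralSet δ) (opU δ) u₀ ⊥ ⊤ (tricomiF δ) := by
  have hS : ∀ u ∈ ladder u₀ ⊥ ⊤, u ∈ spectralSet δ ∧ -u ∈ spectralSet δ := by
    rintro u ⟨m, -, -, rfl⟩
    refine ⟨Or.inr fun e => h' (-m) ?_, Or.inr fun e => h' (-1 - m) ?_⟩ <;> push_cast
    · linear_combination e
    · linear_combination -e
  refine meetsShiftHypotheses_tricomiF hS (fun u hu w hw hC => ?_) (fun u hu w hw hC => ?_)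
  · refine iff_of_false ?_ (by rintro ⟨j, hj, -⟩; exact WithBot.bot_ne_coe hj)
    obtain ⟨m, -, -, rfl⟩ := id hu
    -- The exceptional value $\frac12-2\delta$ equals $-(2\delta+\frac12)+1$, whence the shift by
    -- one.
    refine opA_ne_zero (hS _ hu).1 (fun e => (h (-m)).1 ?_) (fun e => (h (1 - m)).2 ?_) hw hC
      <;> push_cast <;> linear_combination e
  · refine iff_of_false ?_ (by rintro ⟨j, hj, -⟩; exact WithTop.top_ne_coe hj)
    obtain ⟨m, -, -, rfl⟩ := id hu
    refine opA_ne_zero (hS _ hu).2 (fun e => (h (-m)).2 ?_) (fun e => (h (-1 - m)).1 ?_) hw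
      (by rw [opC_neg, hC]) <;> push_cast <;> linear_combination -e

theorem meetsShiftHypotheses_halfInfinite {δ : ℂ} (h : ∀ n : ℕ, -4 * δ - 1 ≠ n) (hδ : δ ≠ 0) :
    MeetsShiftHypotheses (spectralSet δ) (opU δ) (-2 * δ - 1 / 2) ⊥ ((1 : ℤ) : WithTop ℤ)
      (tricomiF δ) := by
  have hn : ∀ u ∈ ladder (-2 * δ - 1 / 2) ⊥ ((1 : ℤ) : WithTop ℤ),
      ∃ n : ℕ, u = -2 * δ - 1 / 2 - n := by
    intro u hu
    obtain ⟨n, hn⟩ := exists_nat_of_mem_ladder_top hu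
    exact ⟨n, by rw [hn]; push_cast; ring⟩
  have hS : ∀ u ∈ ladder (-2 * δ - 1 / 2) ⊥ ((1 : ℤ) : WithTop ℤ),
      u ∈ spectralSet δ ∧ -u ∈ spectralSet δ := by
    intro u hu
    obtain ⟨n, rfl⟩ := hn u hu
    refine ⟨Or.inr fun e => h (2 * n + 1) ?_, Or.inr fun e => ?_⟩
    · push_cast
      linear_combination 2 * e
    -- Here $-u=\frac12$ means $2\delta=-n$: at $n=0$ this contradicts $\delta\ne0$, otherwise the
    -- condition on $-4\delta-1$.
    · rcases n with _ | n
      · exact hδ (by push_cast at e; linear_combination e / 2)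
      · refine h (2 * n + 1) ?_
        push_cast at e ⊢
        linear_combination -2 * e
  refine meetsShiftHypotheses_tricomiF hS (fun u hu w hw hC => ?_) (fun u hu w hw hC => ?_)
  · refine iff_of_false ?_ (by rintro ⟨j, hj, -⟩; exact WithBot.bot_ne_coe hj)
    obtain ⟨n, rfl⟩ := hn u hu
    -- The value $\frac12+2\delta$ would force $-4\delta-1=n$, and $\frac12-2\delta$ lies one step
    -- above the top of the ladder.
    refine opA_ne_zero (hS _ hu).1 (fun e => h n ?_) (fun e => ?_) hw hC
    · linear_combination e
    · refine Nat.cast_add_one_ne_zero (R := ℂ) n ?_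
      linear_combination -e
  · obtain ⟨n, rfl⟩ := hn u hu
    rcases n with _ | n
    · refine iff_of_true (opA_neg_eq_zero hδ (by push_cast; ring) hC) ⟨1, rfl, ?_⟩
      push_cast
      ring
    · refine iff_of_false (opA_ne_zero (hS _ hu).2 (fun e => ?_) (fun e => h n ?_) hw
        (by rw [opC_neg, hC])) ?_
      · refine Nat.cast_add_one_ne_zero (R := ℂ) n ?_
        push_cast at e
        linear_combination e
      · push_cast at e
        linear_combination -e
      · rintro ⟨j, hj, e⟩
        have hj1 : (1 : ℤ) = j := WithTop.coe_injective hj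
        refine Nat.cast_add_one_ne_zero (R := ℂ) n ?_
        rw [← hj1] at e
        push_cast at e
        linear_combination -e

/-- The ladder consists of the integers from $-m$ to $m$ and is symmetric, so one criterion for
$A(k)$ settles both ends; $2m+1$ is $-4\delta$. -/
theorem meetsShiftHypotheses_finite {δ : ℂ} {m : ℕ} (h : 2 * δ + 1 / 2 = -(m : ℂ)) :
    MeetsShiftHypotheses (spectralSet δ) (opU δ) (2 * δ + 1 / 2)
      ((-1 : ℤ) : WithBot ℤ) ((2 * m + 1 : ℤ) : WithTop ℤ) (tricomiF δ) := by
  have hint : ∀ k : ℤ, (k : ℂ) ≠ 1 / 2 := by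
    intro k e
    have e2 : ((2 * k : ℤ) : ℂ) = ((1 : ℤ) : ℂ) := by push_cast; rw [e]; norm_num
    have := Int.cast_injective e2
    omega
  have hδ : δ ≠ 0 := by
    rintro rfl
    refine hint (-m) ?_
    push_cast
    linear_combination -h
  have hk : ∀ u ∈ ladder (2 * δ + 1 / 2) ((-1 : ℤ) : WithBot ℤ) ((2 * m + 1 : ℤ) : WithTop ℤ),
      ∃ k : ℤ, -m ≤ k ∧ k ≤ m ∧ u = k := by
    rintro u ⟨k, h1, h2, rfl⟩
    have h1 : -1 < k := WithBot.coe_lt_coe.1 h1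
    have h2 : k < 2 * m + 1 := WithTop.coe_lt_coe.1 h2
    refine ⟨k - m, by omega, by omega, ?_⟩
    push_cast
    linear_combination h
  have hS : ∀ u ∈ ladder (2 * δ + 1 / 2) ((-1 : ℤ) : WithBot ℤ) ((2 * m + 1 : ℤ) : WithTop ℤ),
      u ∈ spectralSet δ ∧ -u ∈ spectralSet δ := by
    intro u hu
    obtain ⟨k, -, -, rfl⟩ := hk u hu
    refine ⟨Or.inr (hint k), Or.inr ?_⟩
    have := hint (-k)
    rwa [Int.cast_neg] at this
  have hA : ∀ k : ℤ, -m ≤ k → k ≤ m → ∀ w : rapidSpace, w ≠ 0 → opC δ k w = 0 →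
      (opA δ k w = 0 ↔ k = -m) := by
    intro k h1 h2 w hw hC
    by_cases hkm : k = -m
    · refine iff_of_true ?_ hkm
      have := opA_neg_eq_zero hδ (u := -(k : ℂ)) (w := w)
        (by rw [hkm]; push_cast; linear_combination h) (by rw [opC_neg, hC])
      rwa [neg_neg] at this
    · refine iff_of_false (opA_ne_zero (Or.inr (hint k)) (fun e => hkm ?_) (fun e => ?_) hw hC) hkm
      · have e2 : (k : ℂ) = ((-m : ℤ) : ℂ) := by push_cast; linear_combination e + h
        exact Int.cast_injective e2
      -- The second exceptional value $\frac12-2\delta=m+1$ falls just outside the ladder.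
      · have e2 : (k : ℂ) = ((m + 1 : ℤ) : ℂ) := by push_cast; linear_combination e - h
        have := Int.cast_injective e2
        omega
  refine meetsShiftHypotheses_tricomiF hS (fun u hu w hw hC => ?_) (fun u hu w hw hC => ?_)
  · obtain ⟨k, h1, h2, rfl⟩ := hk u hu
    rw [hA k h1 h2 w hw hC]
    constructor
    · rintro rfl
      refine ⟨-1, rfl, ?_⟩
      push_cast
      linear_combination -h
    · rintro ⟨j, hj, e⟩
      rw [← WithBot.coe_injective hj] at e
      have e2 : (k : ℂ) = ((-m : ℤ) : ℂ) := by push_cast at e ⊢; linear_combination e + h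
      exact Int.cast_injective e2
  · obtain ⟨k, h1, h2, rfl⟩ := hk u hu
    have h3 := hA (-k) (by omega) (by omega) w hw (by rw [Int.cast_neg, opC_neg, hC])
    rw [Int.cast_neg] at h3
    rw [h3]
    constructor
    · intro hkm
      obtain rfl : k = m := by omega
      refine ⟨2 * m + 1, rfl, ?_⟩
      push_cast
      linear_combination -h
    · rintro ⟨j, hj, e⟩
      rw [← WithTop.coe_injective hj] at e
      have e2 : (k : ℂ) = ((m : ℤ) : ℂ) := by push_cast at e ⊢; linear_combination e + h
      have := Int.cast_injective e2
      omega

end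

theorem mainTheorem10 (δ : ℂ) :
    ∃ F : ℂ → rapidSpace,
      (∀ (u : ℂ) (x : ℝ), 0 < x → (F u).1 x =
        (x : ℂ) ^ u * Complex.exp (-(x : ℂ) / 2) * tricomiPsi (2 * δ + 1 / 2 + u) (2 * u + 1) x) ∧
      (∀ u₀ : ℂ, (∀ k : ℤ, u₀ ≠ (2 * δ + 1 / 2) + k ∧ u₀ ≠ -(2 * δ + 1 / 2) + k) →
        (∀ k : ℤ, u₀ ≠ 1 / 2 + k) →
        MeetsShiftHypotheses (spectralSet δ) (opU δ) u₀ ⊥ ⊤ F) ∧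
      ((∀ n : ℕ, -4 * δ - 1 ≠ n) → δ ≠ 0 →
        MeetsShiftHypotheses (spectralSet δ) (opU δ) (-2 * δ - 1 / 2) ⊥ ((1 : ℤ) : WithTop ℤ) F ∧
        ∀ u ∈ ladder (-2 * δ - 1 / 2) ⊥ ((1 : ℤ) : WithTop ℤ), IsLaguerreForm δ u (F u)) ∧
      (∀ m : ℕ, 2 * δ + 1 / 2 = -(m : ℂ) →
        MeetsShiftHypotheses (spectralSet δ) (opU δ) (2 * δ + 1 / 2)
          ((-1 : ℤ) : WithBot ℤ) ((2 * m + 1 : ℤ) : WithTop ℤ) F ∧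
        ∀ u ∈ ladder (2 * δ + 1 / 2) ((-1 : ℤ) : WithBot ℤ) ((2 * m + 1 : ℤ) : WithTop ℤ),
          IsLaguerreForm δ u (F u)) := by
  refine ⟨tricomiF δ, fun u x hx => tricomiF_apply δ u hx,
    fun u₀ h h' => meetsShiftHypotheses_infinite h h',
    fun h hδ => ⟨meetsShiftHypotheses_halfInfinite h hδ, fun u hu => ?_⟩,
    fun m h => ⟨meetsShiftHypotheses_finite h, fun u hu => ?_⟩⟩
  · obtain ⟨n, hn⟩ := exists_nat_of_mem_ladder_top hu
    exact isLaguerreForm_tricomiF (n := n) (by rw [hn]; push_cast; ring)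
  · obtain ⟨n, hn⟩ := exists_nat_of_mem_ladder_top hu
    -- The top of the finite ladder, $2\delta+\frac12+2m$, is $-2\delta-\frac12$, so $n$ counts
    -- steps down from it.
    refine isLaguerreForm_tricomiF (n := n) ?_
    rw [hn]
    push_cast
    linear_combination 2 * h
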